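/- All graphs are finite and simple. A set $S$ of vertices of a graph $G$ is a forcing set if, starting from $S$ as the set of colored vertices and repeatedly letting a colored vertex with exactly one uncolored neighbor color that neighbor, all vertices become colored; it is a total forcing set if moreover the subgraph induced by $S$ has no isolated vertex. The total forcing number $F_t(G)$ is the minimum cardinality of a total forcing set of $G$. A path cover of $G$ is a collection of paths of $G$ (possibly consisting of a single vertex) such that every vertex of $G$ lies on exactly one of them, and the path cover number $\mathrm{pc}(G)$ is the minimum number of paths in a path cover. For a tree $T$ with at least two vertices, the trimmed tree $\mathrm{trim}(T)$ is the tree obtained from $T$ by iteratively contracting edges that have one end of degree exactly $2$ and the other end of degree at most $2$, until no such edge remains. Theorem. For every tree $T$ with at least two vertices, \[ \mathrm{pc}(T)+1 \le F_t(T) \le 2\,\mathrm{pc}(T), \] and all values in this range occur: for all integers $\ell \ge 1$ and $m$ with $\ell+1 \le m \le 2\ell$ there is a tree $T$ with at least two vertices, $\mathrm{pc}(T)=\ell$ and $F_t(T)=m$. Further, for every tree $T$ with at least two vertices: (a) $F_t(T)=\mathrm{pc}(T)+1$ if and only if $\mathrm{trim}(T)\cong P_2$ or $\mathrm{trim}(T)\cong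 K_{1,n-1}$ for some $n\ge 4$ (whatever the order in which the edges are contracted); (b) $F_t(T)=2\,\mathrm{pc}(T)$ if and only if $T$ has a unique minimum path cover and every path in this cover starts and ends at distinct leaves (vertices of degree $1$) of $T$. -/

import Mathlib

namespace SimpleGraph

variable {V : Type*}

/-- One step of the forcing process: a colored vertex `u` whose only uncolored neighbor is `v`
forces `v` to become colored. -/
def ForceStep (G : SimpleGraph V) (A B : Set V) : Prop :=
  ∃ u ∈ A, ∃ v, G.neighborSet u \ A = {v} ∧ B = insert v A

/-- `S` is a (zero) forcing set: iterating the forcing process from `S` colors every vertex. -/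
def IsForcingSet (G : SimpleGraph V) (S : Set V) : Prop :=
  Relation.ReflTransGen G.ForceStep S Set.univ

/-- `S` is a total forcing set: a forcing set that induces a subgraph without isolated vertices. -/
def IsTotalForcingSet (G : SimpleGraph V) (S : Set V) : Prop :=
  G.IsForcingSet S ∧ ∀ v ∈ S, ∃ w ∈ S, G.Adj v w

/-- The total forcing number: the minimum cardinality of a total forcing set. -/
noncomputable def totalForcingNumber (G : SimpleGraph V) : ℕ :=
  sInf {k | ∃ S : Finset V, G.IsTotalForcingSet (S : Set V) ∧ S.card = k}

/-- The subgraph `P` is a path of `G` with ends `u` and `v` (trivial if it is a single vertex). -/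
def IsPathBetween (G : SimpleGraph V) (P : G.Subgraph) (u v : V) : Prop :=
  ∃ p : G.Walk u v, p.IsPath ∧ p.toSubgraph = P

/-- A path cover: a finite collection of paths of `G` such that every vertex lies on exactly one of
them. -/
def IsPathCover (G : SimpleGraph V) (C : Finset G.Subgraph) : Prop :=
  (∀ P ∈ C, ∃ u v, G.IsPathBetween P u v) ∧ ∀ x : V, ∃! P : G.Subgraph, P ∈ C ∧ x ∈ P.verts

/-- The path cover number: the minimum cardinality of a path cover. -/
noncomputable def pathCoverNumber (G : SimpleGraph V) : ℕ :=
  sInf {k | ∃ C : Finset G.Subgraph, G.IsPathCover C ∧ C.card = k}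

/-- A minimum path cover. -/
def IsMinimumPathCover (G : SimpleGraph V) (C : Finset G.Subgraph) : Prop :=
  G.IsPathCover C ∧ C.card = G.pathCoverNumber

/-- The number of neighbors of a vertex of a finite graph. -/
noncomputable def vertexDegree (G : SimpleGraph V) (v : V) : ℕ :=
  (G.neighborSet v).ncard

/-- A leaf: a vertex of degree one. -/
def IsLeafVertex (G : SimpleGraph V) (v : V) : Prop :=
  G.vertexDegree v = 1

/-- The contraction of the edge `xy`: `x` and `y` are replaced by one vertex (which keeps the
name `x`), and it is joined to all other vertices that were adjacent to `x` or `y`. -/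
def contractEdge (G : SimpleGraph V) (x y : V) : SimpleGraph {v : V // v ≠ y} where
  Adj a b := a ≠ b ∧
    (G.Adj a b ∨ ((a : V) = x ∧ G.Adj y b) ∨ ((b : V) = x ∧ G.Adj a y))
  symm := ⟨by
    rintro a b ⟨hab, h⟩
    refine ⟨hab.symm, ?_⟩
    rcases h with h | ⟨h, h'⟩ | ⟨h, h'⟩
    · exact Or.inl h.symm
    · exact Or.inr (Or.inr ⟨h, h'.symm⟩)
    · exact Or.inr (Or.inl ⟨h, h'.symm⟩)⟩
  loopless := ⟨fun _ h => h.1 rfl⟩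

/-- `xy` is an edge with one end of degree exactly `2` and the other of degree at most `2`. -/
def IsTrimmableEdge (G : SimpleGraph V) (x y : V) : Prop :=
  G.Adj x y ∧ ((G.vertexDegree x = 2 ∧ G.vertexDegree y ≤ 2) ∨
    (G.vertexDegree y = 2 ∧ G.vertexDegree x ≤ 2))

universe u w

/-- `IsTrimOf H G`: up to isomorphism, `H` results from `G` by contracting trimmable edges one
after another, in some order, until no trimmable edge remains. -/
inductive IsTrimOf {W : Type w} (H : SimpleGraph W) : {V : Type u} → SimpleGraph V → Prop
  | done {V : Type u} (G : SimpleGraph V) (hG : ∀ x y, ¬ G.IsTrimmableEdge x y)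
      (e : G ≃g H) : IsTrimOf H G
  | contract {V : Type u} (G : SimpleGraph V) (x y : V) (hxy : G.IsTrimmableEdge x y)
      (h : IsTrimOf H (G.contractEdge x y)) : IsTrimOf H G

end SimpleGraph

/-!
The proof translates path covers into linear forests. In an acyclic graph `T` on `n` vertices the
path covers correspond to the spanning subgraphs `F ≤ T` of maximum degree at most two, the members
of the cover being the components of `F` (`coverGraph`, `IsAcyclic.exists_isPathCover`), and a cover
by `k` paths has `n - k` edges. So `pc(T)` is `n` minus the largest number of edges of such an `F`.

Forcing and linear forests are linked in both directions.
* A forcing process gives each vertex outside `S` a forcing vertex, injectively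
  (`IsChronology`), so the forcing edges are a linear forest with `n - |S|` edges in which the
  vertices of `S` start the chains. Edges of a matching inside `S` can be added to it
  (`IsChronology.pathCoverNumber_add_ncard_edgeSet_le`); a total forcing set contains an edge, hence
  `pc + 1 ≤ F_t`. A leaf never forces when `S` is total, hence `F_t` is at least the number of
  leaves (`IsTotalForcingSet.ncard_isLeafVertex_le`).
* Given a path cover of a tree, an end or two consecutive vertices of each path force everything
  (`IsAcyclic.isForcingSet`), because a stuck process would produce an endless non-backtracking
  walk. This gives `F_t ≤ 2 pc` (`IsTree.totalForcingNumber_add_card_le`).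

For (a), if `F_t = pc + 1` then a minimum total forcing set contains no two disjoint edges, so it
spans a star with some center `c`; the star and the forcing edges have `n - 1` edges together, so
they are all of `T`, and every vertex other than `c` has degree at most two. Conversely such a `T`
is forced by `c` and all but one of its neighbors, while `pc ≥ deg c - 1`. Contracting trimmable
edges preserves the property of having at most one vertex of degree three or more, and for a trimmed
tree the property means being `P₂` or a star with at least three leaves.

For (b), if every path of a minimum cover joins two distinct leaves, there are at least `2 pc`
leaves, so `F_t ≥ 2 pc`. If `F_t = 2 pc`, then in every minimum cover each end of a path has all its
`T`-edges on the path: an edge `vw` off the cover at an end `v` would save one vertex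
(`IsTree.totalForcingNumber_lt_two_mul`). Hence the ends are leaves, and two such linear forests
coincide since their symmetric difference has no vertex of degree one.

All values occur for caterpillars with `m` leaves and a spine of `m - l` vertices, two leaves being
attached to every spine vertex but the last, which carries the rest.
-/

namespace SimpleGraph

universe u w

variable {V : Type u}

/-! ### Acyclic graphs and degrees -/

/-- A finite acyclic graph carries no infinite non-backtracking walk: a set of darts `D` in which
every dart `(a, b)` is continued by some dart `(b, c)` with `c ≠ a` is empty. It
is used for the forcing process and for the uniqueness of linear forests. -/
theorem IsAcyclic.not_dart_of_continues [Finite V] {T : SimpleGraph V} (hT : T.IsAcyclic)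
    {D : V → V → Prop} (hD : ∀ a b, D a b → T.Adj a b)
    (hc : ∀ a b, D a b → ∃ c, c ≠ a ∧ D b c) (a b : V) : ¬ D a b := by
  intro hab
  have := Fintype.ofFinite V
  -- The walk is recorded backwards, so that prolonging it is a `Walk.cons`.
  have key : ∀ k : ℕ, ∃ (x y z : V) (h : T.Adj y x) (q : T.Walk x z),
      (Walk.cons h q).IsPath ∧ q.length = k ∧ D x y := by
    intro k
    induction k with
    | zero =>
      refine ⟨a, b, a, (hD a b hab).symm, Walk.nil, ?_, rfl, hab⟩
      simpa using (hD a b hab).ne'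
    | succ k ih =>
      obtain ⟨x, y, z, h, q, hp, hk, hxy⟩ := ih
      obtain ⟨c, hcx, hyc⟩ := hc x y hxy
      refine ⟨y, c, z, (hD y c hyc).symm, Walk.cons h q, ?_, by simp [hk], hyc⟩
      refine (Walk.cons_isPath_iff _ _).2 ⟨hp, fun hmem => hcx ?_⟩
      simpa using hT.eq_snd_of_adj_start hp (hD y c hyc) hmem
  obtain ⟨x, y, z, h, q, hp, hk, -⟩ := key (Fintype.card V)
  have := hp.length_lt
  simp [hk] at this

theorem vertexDegree_le_two_of_forall [Finite V] {G : SimpleGraph V} {v a b : V}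
    (h : ∀ w, G.Adj v w → w = a ∨ w = b) : G.vertexDegree v ≤ 2 := by
  refine (Set.ncard_le_ncard (t := {a, b}) (fun w hw => ?_) (Set.toFinite _)).trans
    ((Set.ncard_insert_le _ _).trans (by rw [Set.ncard_singleton]))
  simpa using h w hw

theorem vertexDegree_le_one_iff [Finite V] {G : SimpleGraph V} {v : V} :
    G.vertexDegree v ≤ 1 ↔ ∀ a b, G.Adj v a → G.Adj v b → a = b := by
  unfold vertexDegree
  rw [Set.ncard_le_one (Set.toFinite _)]
  exact ⟨fun h a b ha hb => h a ha b hb, fun h a ha b hb => h a b ha hb⟩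

theorem vertexDegree_pos_iff [Finite V] {G : SimpleGraph V} {v : V} :
    0 < G.vertexDegree v ↔ ∃ w, G.Adj v w := by
  unfold vertexDegree
  rw [Set.ncard_pos (Set.toFinite _)]
  rfl

/-- A vertex of degree at most two has no three distinct neighbors. -/
theorem eq_or_eq_of_vertexDegree_le_two [Finite V] {G : SimpleGraph V} {v a b c : V}
    (hd : G.vertexDegree v ≤ 2) (ha : G.Adj v a) (hb : G.Adj v b) (hab : a ≠ b)
    (hc : G.Adj v c) : c = a ∨ c = b := by
  by_contra! hne
  have h3 : ({c, a, b} : Set V).ncard = 3 :=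
    Set.ncard_eq_three.2 ⟨c, a, b, hne.1, hne.2, hab, rfl⟩
  have : ({c, a, b} : Set V).ncard ≤ G.vertexDegree v := by
    refine Set.ncard_le_ncard ?_ (Set.toFinite _)
    rintro w (rfl | rfl | rfl) <;> assumption
  omega

theorem IsTree.exists_adj [Nontrivial V] {T : SimpleGraph V} (hT : T.IsTree) (v : V) :
    ∃ w, T.Adj v w :=
  hT.connected.preconnected.exists_adj_of_nontrivial v

theorem IsTree.ncard_edgeSet [Finite V] {T : SimpleGraph V} (hT : T.IsTree) :
    T.edgeSet.ncard + 1 = Nat.card V :=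
  (isTree_iff_connected_and_card.1 hT).2

/-! ### Forcing sets from spanning linear forests -/

theorem IsForcingSet.mono {G : SimpleGraph V} {S S' : Set V} (h : G.IsForcingSet S)
    (hS : S ⊆ S') : G.IsForcingSet S' := by
  have key : ∀ A, Relation.ReflTransGen G.ForceStep S A →
      ∃ A', A ⊆ A' ∧ Relation.ReflTransGen G.ForceStep S' A' := by
    intro A hA
    induction hA with
    | refl => exact ⟨S', hS, .refl⟩
    | @tail A B _ hAB ih =>
      obtain ⟨A', hAA', hA'⟩ := ih
      obtain ⟨u, hu, v, huv, rfl⟩ := hAB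
      by_cases hv : v ∈ A'
      · exact ⟨A', Set.insert_subset hv hAA', hA'⟩
      · refine ⟨insert v A', Set.insert_subset_insert hAA', hA'.tail ⟨u, hAA' hu, v, ?_, rfl⟩⟩
        refine Set.Subset.antisymm (huv ▸ Set.sdiff_subset_sdiff_right hAA') ?_
        intro w hw
        rw [Set.mem_singleton_iff.1 hw]
        have : v ∈ G.neighborSet u \ A := huv ▸ rfl
        exact ⟨this.1, hv⟩
  obtain ⟨A', hA', h'⟩ := key _ h
  rw [Set.univ_subset_iff.1 hA'] at h'
  exact h'

/-- Let `F` be a spanning subgraph of a finite acyclic graph `T`. If `S` meets every component of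
`F`, no vertex of `S` has two `F`-neighbors outside `S`, and outside `S` the degrees of `F` are at
most two, then `S` is a forcing set of `T`.

Only forces along edges of `F` are used. Were the process stuck, every colored vertex with an
uncolored `F`-neighbor would also have an uncolored neighbor in another component of `F`; moving
there, and from there along `F` towards the colored part, would give an endless non-backtracking
walk. -/
theorem IsAcyclic.isForcingSet [Finite V] {T F : SimpleGraph V} (hT : T.IsAcyclic) (hF : F ≤ T)
    {S : Set V} (hreach : ∀ v, ∃ s ∈ S, F.Reachable v s)
    (hS : ∀ s ∈ S, ∀ a b, F.Adj s a → F.Adj s b → a ∉ S → b ∉ S → a = b)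
    (hdeg : ∀ v ∉ S, F.vertexDegree v ≤ 2) : T.IsForcingSet S := by
  -- Induction on the number of uncolored vertices.
  induction hn : Sᶜ.ncard using Nat.strong_induction_on generalizing S with
  | _ n ih =>
  by_cases huniv : S = Set.univ
  · subst huniv
    exact Relation.ReflTransGen.refl
  by_cases hstep : ∃ u ∈ S, ∃ v, F.Adj u v ∧ v ∉ S ∧ ∀ w, T.Adj u w → w ∉ S → w = v
  · obtain ⟨u, hu, v, huv, hv, honly⟩ := hstep
    refine Relation.ReflTransGen.head (b := insert v S) ⟨u, hu, v, ?_, rfl⟩ ?_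
    · ext w
      simp only [Set.mem_sdiff, mem_neighborSet, Set.mem_singleton_iff]
      exact ⟨fun h => honly w h.1 h.2, fun h => h ▸ ⟨hF huv, hv⟩⟩
    · refine ih _ ?_ (fun w => ?_) ?_ ?_ rfl
      · rw [← hn]
        refine Set.ncard_lt_ncard ?_ (Set.toFinite _)
        exact compl_lt_compl_iff_lt.2 (Set.ssubset_insert hv)
      · obtain ⟨s, hs, h⟩ := hreach w
        exact ⟨s, Set.mem_insert_of_mem _ hs, h⟩
      · rintro s (rfl | hs) a b ha hb haS hbS
        · simp only [Set.mem_insert_iff, not_or] at haS hbS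
          by_contra hab
          rcases eq_or_eq_of_vertexDegree_le_two (hdeg s hv) ha hb hab huv.symm with h | h
          · exact haS.2 (h ▸ hu)
          · exact hbS.2 (h ▸ hu)
        · simp only [Set.mem_insert_iff, not_or] at haS hbS
          exact hS s hs a b ha hb haS.2 hbS.2
      · intro w hw
        exact hdeg w fun h => hw (Set.mem_insert_of_mem _ h)
  · exfalso
    push Not at hstep
    -- The distance in `F` from a vertex to the colored set.
    let d : V → ℕ := fun v => sInf {k | ∃ s ∈ S, ∃ p : F.Walk v s, p.length = k}
    have hd : ∀ v, ∃ s ∈ S, ∃ p : F.Walk v s, p.length = d v := fun v => by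
      obtain ⟨s, hs, ⟨p⟩⟩ := hreach v
      exact Nat.sInf_mem (s := {k | ∃ s ∈ S, ∃ p : F.Walk v s, p.length = k}) ⟨_, s, hs, p, rfl⟩
    have hnext : ∀ v ∉ S, ∃ w, F.Adj v w ∧ d w < d v := fun v hv => by
      obtain ⟨s, hs, p, hp⟩ := hd v
      cases p with
      | nil => exact absurd hs hv
      | cons h q =>
        refine ⟨_, h, ?_⟩
        rw [← hp, Walk.length_cons, Nat.lt_succ_iff]
        exact Nat.sInf_le ⟨s, hs, q, rfl⟩
    -- Darts: from an uncolored vertex one step towards the colored set along `F`, or from a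
    -- colored vertex with an uncolored `F`-neighbor to an uncolored vertex off `F`.
    let D : V → V → Prop := fun a b =>
      (a ∉ S ∧ F.Adj a b ∧ d b < d a) ∨ (a ∈ S ∧ b ∉ S ∧ T.Adj a b ∧ ¬ F.Adj a b)
    have hDc : ∀ a b, D a b → ∃ c, c ≠ a ∧ D b c := by
      rintro a b (⟨ha, hab, hlt⟩ | ⟨ha, hb, hab, hnF⟩)
      · by_cases hb : b ∈ S
        · obtain ⟨w, hbw, hw, hwa⟩ := hstep b hb a hab.symm ha
          refine ⟨w, hwa, Or.inr ⟨hb, hw, hbw, fun h => hwa ?_⟩⟩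
          exact hS b hb w a h hab.symm hw ha
        · obtain ⟨c, hbc, hc⟩ := hnext b hb
          exact ⟨c, fun h => by subst h; omega, Or.inl ⟨hb, hbc, hc⟩⟩
      · obtain ⟨c, hbc, hc⟩ := hnext b hb
        exact ⟨c, fun h => hnF (h ▸ hbc.symm), Or.inl ⟨hb, hbc, hc⟩⟩
    obtain ⟨v, hv⟩ := (Set.ne_univ_iff_exists_notMem S).1 huniv
    obtain ⟨w, hvw, hlt⟩ := hnext v hv
    refine hT.not_dart_of_continues (D := D) ?_ hDc v w (Or.inl ⟨hv, hvw, hlt⟩)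
    rintro a b (⟨-, h, -⟩ | ⟨-, -, h, -⟩)
    exacts [hF h, h]

/-! ### Chronologies of the forcing process -/

/-- A chronology of the forcing process started at `S`: `t v` is the time at which `v` is colored,
and `p v` is the vertex that forces `v` (for `v ∉ S`; on `S` the map `p` carries no information). -/
structure IsChronology (G : SimpleGraph V) (S : Set V) (t : V → ℕ) (p : V → V) : Prop where
  adj : ∀ v ∉ S, G.Adj (p v) v
  lt : ∀ v ∉ S, t (p v) < t v
  lt_of_adj : ∀ v ∉ S, ∀ w, G.Adj (p v) w → w ≠ v → t w < t v

theorem IsForcingSet.exists_isChronology {G : SimpleGraph V} {S : Set V} (h : G.IsForcingSet S) :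
    ∃ t p, G.IsChronology S t p := by
  have key : ∀ A, Relation.ReflTransGen G.ForceStep S A →
      ∃ (t : V → ℕ) (p : V → V) (N : ℕ), (∀ v ∈ A, t v < N) ∧ ∀ v ∈ A, v ∉ S →
        p v ∈ A ∧ G.Adj (p v) v ∧ t (p v) < t v ∧
          ∀ w, G.Adj (p v) w → w ≠ v → w ∈ A ∧ t w < t v := by
    classical
    intro A hA
    induction hA with
    | refl => exact ⟨fun _ => 0, id, 1, fun _ _ => one_pos, fun v hv hv' => absurd hv hv'⟩
    | @tail A B _ hAB ih =>
      obtain ⟨t, p, N, hN, hp⟩ := ih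
      obtain ⟨u, hu, v, huv, rfl⟩ := hAB
      have hv : v ∈ G.neighborSet u \ A := huv ▸ rfl
      have hne : ∀ w ∈ A, w ≠ v := fun w hw h => hv.2 (h ▸ hw)
      have ht : ∀ w ∈ A, Function.update t v N w = t w :=
        fun w hw => Function.update_of_ne (hne w hw) _ _
      refine ⟨Function.update t v N, Function.update p v u, N + 1, ?_, ?_⟩
      · rintro w (rfl | hw)
        · simp
        · rw [ht w hw]
          exact (hN w hw).trans (Nat.lt_succ_self N)
      · rintro w (rfl | hw) hwS
        · simp only [Function.update_self, ht u hu]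
          refine ⟨Set.mem_insert_of_mem _ hu, hv.1, hN u hu, fun x hx hxw => ?_⟩
          have hxA : x ∈ A := by
            by_contra hxA
            have : x ∈ G.neighborSet u \ A := ⟨hx, hxA⟩
            rw [huv] at this
            exact hxw this
          rw [ht x hxA]
          exact ⟨Set.mem_insert_of_mem _ hxA, hN x hxA⟩
        · obtain ⟨h1, h2, h3, h4⟩ := hp w hw hwS
          rw [Function.update_of_ne (hne w hw), ht w hw, ht _ h1]
          refine ⟨Set.mem_insert_of_mem _ h1, h2, h3, fun x hx hxw => ?_⟩
          obtain ⟨h5, h6⟩ := h4 x hx hxw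
          rw [ht x h5]
          exact ⟨Set.mem_insert_of_mem _ h5, h6⟩
  obtain ⟨t, p, N, -, hp⟩ := key _ h
  exact ⟨t, p, fun v hv => (hp v trivial hv).2.1, fun v hv => (hp v trivial hv).2.2.1,
    fun v hv w hw hwv => ((hp v trivial hv).2.2.2 w hw hwv).2⟩

namespace IsChronology

variable {G : SimpleGraph V} {S : Set V} {t : V → ℕ} {p : V → V}

/-- A vertex forces at most one vertex. -/
theorem injOn (h : G.IsChronology S t p) : Set.InjOn p Sᶜ := by
  intro v hv w hw hvw
  by_contra hne
  have h1 := h.lt_of_adj v hv w (hvw ▸ h.adj w hw) (Ne.symm hne)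
  have h2 := h.lt_of_adj w hw v (hvw ▸ h.adj v hv) hne
  omega

theorem apply_apply_ne (h : G.IsChronology S t p) {v : V} (hv : v ∉ S) (hpv : p v ∉ S) :
    p (p v) ≠ v := by
  intro heq
  have h1 := h.lt v hv
  have h2 := h.lt _ hpv
  rw [heq] at h2
  omega

/-- A leaf of `G` forces nothing when `S` is a total forcing set: a leaf in `S` has its only
neighbor in `S`, and any other leaf has been forced by its only neighbor. -/
theorem not_isLeafVertex [Finite V] (h : G.IsChronology S t p)
    (hS : ∀ v ∈ S, ∃ w ∈ S, G.Adj v w) {v : V} (hv : v ∉ S) : ¬ G.IsLeafVertex (p v) := by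
  intro hleaf
  have hu := vertexDegree_le_one_iff.1 (le_of_eq hleaf)
  by_cases hpv : p v ∈ S
  · obtain ⟨w, hw, hadj⟩ := hS _ hpv
    exact hv (hu w v hadj (h.adj v hv) ▸ hw)
  · exact h.apply_apply_ne hv hpv (hu _ v (h.adj _ hpv).symm (h.adj v hv))

end IsChronology

/-- A total forcing set has at least as many vertices as there are leaves. -/
theorem IsTotalForcingSet.ncard_isLeafVertex_le [Finite V] {G : SimpleGraph V} {S : Set V}
    (h : G.IsTotalForcingSet S) : {v | G.IsLeafVertex v}.ncard ≤ S.ncard := by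
  obtain ⟨t, p, hp⟩ := h.1.exists_isChronology
  have h1 : Sᶜ.ncard ≤ ({v | G.IsLeafVertex v}ᶜ).ncard :=
    Set.ncard_le_ncard_of_injOn p (fun v hv => hp.not_isLeafVertex h.2 hv) hp.injOn
      (Set.toFinite _)
  have h2 := Set.ncard_add_ncard_compl S
  have h3 := Set.ncard_add_ncard_compl {v | G.IsLeafVertex v}
  omega

/-! ### The total forcing number -/

theorem totalForcingNumber_le {G : SimpleGraph V} {S : Set V} (hfin : S.Finite)
    (h : G.IsTotalForcingSet S) : G.totalForcingNumber ≤ S.ncard := by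
  refine Nat.sInf_le ⟨hfin.toFinset, by simpa using h, ?_⟩
  rw [Set.ncard_eq_toFinset_card _ hfin]

theorem IsTree.exists_isTotalForcingSet [Finite V] [Nontrivial V] {T : SimpleGraph V}
    (hT : T.IsTree) : ∃ S : Set V, T.IsTotalForcingSet S ∧ S.ncard = T.totalForcingNumber := by
  have := Fintype.ofFinite V
  have hne : {k | ∃ S : Finset V, T.IsTotalForcingSet (S : Set V) ∧ S.card = k}.Nonempty := by
    refine ⟨_, Finset.univ, ⟨?_, fun v _ => ?_⟩, rfl⟩
    · rw [Finset.coe_univ]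
      exact Relation.ReflTransGen.refl
    · obtain ⟨w, hw⟩ := hT.exists_adj v
      exact ⟨w, by simp, hw⟩
  obtain ⟨S, hS, hk⟩ := Nat.sInf_mem hne
  exact ⟨S, hS, by rw [Set.ncard_coe_finset]; exact hk⟩

theorem IsTree.ncard_isLeafVertex_le_totalForcingNumber [Finite V] [Nontrivial V]
    {T : SimpleGraph V} (hT : T.IsTree) :
    {v | T.IsLeafVertex v}.ncard ≤ T.totalForcingNumber := by
  obtain ⟨S, hS, h⟩ := hT.exists_isTotalForcingSet
  exact h ▸ hS.ncard_isLeafVertex_le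

/-! ### Path covers as spanning linear forests -/

/-- The spanning subgraph formed by the edges of the members of `C`. For a path cover `C` it is a
linear forest whose components are the members of `C`. -/
def coverGraph {G : SimpleGraph V} (C : Finset G.Subgraph) : SimpleGraph V where
  Adj u v := ∃ P ∈ C, P.Adj u v
  symm := ⟨fun _ _ ⟨P, hP, h⟩ => ⟨P, hP, h.symm⟩⟩
  loopless := ⟨fun v ⟨_, _, h⟩ => G.loopless.irrefl v h.adj_sub⟩

theorem coverGraph_adj {G : SimpleGraph V} {C : Finset G.Subgraph} {u v : V} :
    (coverGraph C).Adj u v ↔ ∃ P ∈ C, P.Adj u v := Iff.rfl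

theorem coverGraph_le {G : SimpleGraph V} (C : Finset G.Subgraph) : coverGraph C ≤ G :=
  fun _ _ ⟨_, _, h⟩ => h.adj_sub

namespace IsPathBetween

variable {G : SimpleGraph V} {P : G.Subgraph} {u v : V}

theorem symm (h : G.IsPathBetween P u v) : G.IsPathBetween P v u := by
  obtain ⟨p, hp, rfl⟩ := h
  exact ⟨p.reverse, hp.reverse, p.toSubgraph_reverse⟩

theorem left_mem (h : G.IsPathBetween P u v) : u ∈ P.verts := by
  obtain ⟨p, hp, rfl⟩ := h
  simp

theorem right_mem (h : G.IsPathBetween P u v) : v ∈ P.verts := h.symm.left_mem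

theorem eq_of_adj_left (h : G.IsPathBetween P u v) {a b : V} (ha : P.Adj u a)
    (hb : P.Adj u b) : a = b := by
  obtain ⟨p, hp, rfl⟩ := h
  rw [← hp.snd_of_toSubgraph_adj ha, ← hp.snd_of_toSubgraph_adj hb]

theorem exists_forall_adj (h : G.IsPathBetween P u v) (w : V) :
    ∃ a b, ∀ x, P.Adj w x → x = a ∨ x = b := by
  by_cases hadj : ∃ x, P.Adj w x
  · obtain ⟨y, hy⟩ := hadj
    rcases eq_or_ne w u with rfl | hwu
    · exact ⟨y, y, fun x hx => Or.inl (h.eq_of_adj_left hx hy)⟩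
    rcases eq_or_ne w v with rfl | hwv
    · exact ⟨y, y, fun x hx => Or.inl (h.symm.eq_of_adj_left hx hy)⟩
    obtain ⟨p, hp, rfl⟩ := h
    obtain ⟨i, rfl, hi⟩ := Walk.mem_support_iff_exists_getVert.1
      ((p.mem_verts_toSubgraph).1 (p.toSubgraph.edge_vert hy))
    have h0 : i ≠ 0 := by
      rintro rfl
      simp at hwu
    have h1 : i < p.length := by
      refine lt_of_le_of_ne hi ?_
      rintro rfl
      simp at hwv
    refine ⟨p.getVert (i - 1), p.getVert (i + 1), fun x hx => ?_⟩
    have := hp.neighborSet_toSubgraph_internal h0 h1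
    have hx' : x ∈ p.toSubgraph.neighborSet (p.getVert i) := hx
    rwa [this] at hx'
  · exact ⟨w, w, fun x hx => absurd ⟨x, hx⟩ hadj⟩

theorem ncard_edgeSet_add_one (h : G.IsPathBetween P u v) :
    P.edgeSet.ncard + 1 = P.verts.ncard := by
  classical
  obtain ⟨p, hp, rfl⟩ := h
  have h1 : p.toSubgraph.edgeSet = (p.edges.toFinset : Set (Sym2 V)) := by
    ext e
    simp
  have h2 : p.toSubgraph.verts = (p.support.toFinset : Set V) := by
    ext w
    simp
  rw [h1, h2, Set.ncard_coe_finset, Set.ncard_coe_finset,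
    List.toFinset_card_of_nodup hp.edges_nodup, List.toFinset_card_of_nodup hp.support_nodup]
  simp

/-- If a graph `F` contains all edges of the path `P`, then `F` connects all vertices of `P`. -/
theorem reachable (h : G.IsPathBetween P u v) {F : SimpleGraph V}
    (hF : ∀ a b, P.Adj a b → F.Adj a b) {a b : V} (ha : a ∈ P.verts) (hb : b ∈ P.verts) :
    F.Reachable a b := by
  obtain ⟨p, hp, rfl⟩ := h
  have key : ∀ {x y : V} (q : G.Walk x y), (∀ a b, q.toSubgraph.Adj a b → F.Adj a b) →
      ∀ w ∈ q.support, F.Reachable x w := by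
    intro x y q
    induction q with
    | nil => intro _ w hw; simp at hw; rw [hw]
    | @cons x z y hadj q ih =>
      intro hq w hw
      rw [Walk.support_cons, List.mem_cons] at hw
      rcases hw with rfl | hw
      · exact Reachable.refl _
      · have h1 := hq _ _ (by simp [Walk.toSubgraph] : (Walk.cons hadj q).toSubgraph.Adj x z)
        refine h1.reachable.trans (ih (fun a b hab => hq a b ?_) w hw)
        simp only [Walk.toSubgraph, Subgraph.sup_adj]
        exact Or.inr hab
  exact ((key p hF a (p.mem_verts_toSubgraph.1 ha)).symm).trans
    (key p hF b (p.mem_verts_toSubgraph.1 hb))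

end IsPathBetween

namespace IsPathCover

variable {G : SimpleGraph V} {C : Finset G.Subgraph}

theorem exists_mem (hC : G.IsPathCover C) (v : V) : ∃ P ∈ C, v ∈ P.verts :=
  let ⟨P, hP, _⟩ := hC.2 v
  ⟨P, hP.1, hP.2⟩

theorem eq_of_mem (hC : G.IsPathCover C) {v : V} {P Q : G.Subgraph} (hP : P ∈ C) (hQ : Q ∈ C)
    (hvP : v ∈ P.verts) (hvQ : v ∈ Q.verts) : P = Q :=
  (hC.2 v).unique ⟨hP, hvP⟩ ⟨hQ, hvQ⟩

theorem coverGraph_adj_iff (hC : G.IsPathCover C) {P : G.Subgraph} (hP : P ∈ C) {v w : V}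
    (hv : v ∈ P.verts) : (coverGraph C).Adj v w ↔ P.Adj v w := by
  refine ⟨?_, fun h => ⟨P, hP, h⟩⟩
  rintro ⟨Q, hQ, h⟩
  rwa [hC.eq_of_mem hP hQ hv (Q.edge_vert h)]

theorem vertexDegree_le_two [Finite V] (hC : G.IsPathCover C) (v : V) :
    (coverGraph C).vertexDegree v ≤ 2 := by
  obtain ⟨P, hP, hv⟩ := hC.exists_mem v
  obtain ⟨u, w, h⟩ := hC.1 P hP
  obtain ⟨a, b, hab⟩ := h.exists_forall_adj v
  exact vertexDegree_le_two_of_forall fun x hx => hab x ((hC.coverGraph_adj_iff hP hv).1 hx)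

/-- The members of a path cover are the components of its linear forest. -/
theorem mem_verts_iff (hC : G.IsPathCover C) {P : G.Subgraph} (hP : P ∈ C) {v w : V}
    (hv : v ∈ P.verts) : w ∈ P.verts ↔ (coverGraph C).Reachable v w := by
  constructor
  · intro hw
    obtain ⟨x, y, h⟩ := hC.1 P hP
    exact h.reachable (F := coverGraph C) (fun a b hab => ⟨P, hP, hab⟩) hv hw
  · rintro ⟨p⟩
    induction p with
    | nil => exact hv
    | cons hadj q ih => exact ih (P.edge_vert ((hC.coverGraph_adj_iff hP hv).1 hadj).symm)

/-- A path cover is determined by its linear forest. -/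
theorem eq_of_coverGraph_eq (hC : G.IsPathCover C) {D : Finset G.Subgraph} (hD : G.IsPathCover D)
    (h : coverGraph C = coverGraph D) : C = D := by
  have key : ∀ {C D : Finset G.Subgraph}, G.IsPathCover C → G.IsPathCover D →
      coverGraph C = coverGraph D → ∀ P ∈ C, P ∈ D := by
    intro C D hC hD h P hP
    obtain ⟨u, v, huv⟩ := hC.1 P hP
    obtain ⟨Q, hQ, huQ⟩ := hD.exists_mem u
    have hverts : ∀ w, w ∈ P.verts ↔ w ∈ Q.verts := fun w => by
      rw [hC.mem_verts_iff hP huv.left_mem, hD.mem_verts_iff hQ huQ, h]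
    suffices P = Q from this ▸ hQ
    refine Subgraph.ext (Set.ext hverts) ?_
    ext a b
    constructor
    · intro hab
      have ha := P.edge_vert hab
      rwa [← hD.coverGraph_adj_iff hQ ((hverts a).1 ha), ← h, hC.coverGraph_adj_iff hP ha]
    · intro hab
      have ha := Q.edge_vert hab
      rwa [← hC.coverGraph_adj_iff hP ((hverts a).2 ha), h, hD.coverGraph_adj_iff hQ ha]
  exact Finset.Subset.antisymm (key hC hD h) (key hD hC h.symm)

theorem ncard_edgeSet_add_card [Finite V] (hC : G.IsPathCover C) :
    (coverGraph C).edgeSet.ncard + C.card = Nat.card V := by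
  classical
  have := Fintype.ofFinite V
  have hV : (Finset.univ : Finset V) = C.biUnion fun P => P.verts.toFinset := by
    ext v
    simpa using hC.exists_mem v
  have hE : (coverGraph C).edgeSet.toFinset = C.biUnion fun P => P.edgeSet.toFinset := by
    ext e
    induction e with | h a b => simp [coverGraph_adj]
  have hVd : (C : Set G.Subgraph).PairwiseDisjoint fun P => P.verts.toFinset := by
    intro P hP Q hQ hne
    refine Finset.disjoint_left.2 fun v hv hv' => hne ?_
    exact hC.eq_of_mem hP hQ (Set.mem_toFinset.1 hv) (Set.mem_toFinset.1 hv')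
  have hEd : (C : Set G.Subgraph).PairwiseDisjoint fun P => P.edgeSet.toFinset := by
    intro P hP Q hQ hne
    refine Finset.disjoint_left.2 fun e hv hv' => hne ?_
    induction e with | h a b =>
    simp only [Set.mem_toFinset, Subgraph.mem_edgeSet] at hv hv'
    exact hC.eq_of_mem hP hQ (P.edge_vert hv) (Q.edge_vert hv')
  rw [Set.ncard_eq_toFinset_card', hE, Finset.card_biUnion hEd, Nat.card_eq_fintype_card,
    ← Finset.card_univ, hV, Finset.card_biUnion hVd, Finset.card_eq_sum_ones,
    ← Finset.sum_add_distrib]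
  refine Finset.sum_congr rfl fun P hP => ?_
  obtain ⟨u, v, h⟩ := hC.1 P hP
  rw [← Set.ncard_eq_toFinset_card', ← Set.ncard_eq_toFinset_card', h.ncard_edgeSet_add_one]

end IsPathCover

/-- The component of `v` in a spanning subgraph `F` of `G`, as a subgraph of `G`. -/
def componentSubgraph {F G : SimpleGraph V} (h : F ≤ G) (v : V) : G.Subgraph where
  verts := {w | F.Reachable v w}
  Adj a b := F.Adj a b ∧ F.Reachable v a
  adj_sub hab := h hab.1
  edge_vert hab := hab.2
  symm := ⟨fun _ _ hab => ⟨hab.1.symm, hab.2.trans hab.1.reachable⟩⟩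

/-- In an acyclic graph `F` of maximum degree at most two, every component is a path: a longest
path in it is closed under `F`-adjacency. -/
theorem IsAcyclic.exists_isPathBetween_componentSubgraph [Finite V] {F G : SimpleGraph V}
    (hF : F.IsAcyclic) (hle : F ≤ G) (hdeg : ∀ v, F.vertexDegree v ≤ 2) (v : V) :
    ∃ a b, G.IsPathBetween (componentSubgraph hle v) a b := by
  classical
  have := Fintype.ofFinite V
  let L : Set ℕ := {k | ∃ (a b : V) (p : F.Walk a b), p.IsPath ∧ F.Reachable v a ∧ p.length = k}
  have hLne : L.Nonempty := ⟨0, v, v, Walk.nil, by simp, Reachable.refl _, rfl⟩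
  have hLbdd : BddAbove L := by
    refine ⟨Fintype.card V, ?_⟩
    rintro k ⟨a, b, p, hp, -, rfl⟩
    exact hp.length_lt.le
  obtain ⟨a, b, p, hp, hva, hlen⟩ := Nat.sSup_mem hLne hLbdd
  have hmax : ∀ (a' b' : V) (q : F.Walk a' b'), q.IsPath → F.Reachable v a' →
      q.length ≤ p.length := fun a' b' q hq ha' =>
    hlen ▸ le_csSup hLbdd ⟨a', b', q, hq, ha', rfl⟩
  -- An `F`-neighbor of the first vertex lies on the path, by maximality and acyclicity.
  have hstart : ∀ {a b : V} (p : F.Walk a b), p.IsPath → F.Reachable v a →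
      (∀ (a' b' : V) (q : F.Walk a' b'), q.IsPath → F.Reachable v a' → q.length ≤ p.length) →
      ∀ y, F.Adj a y → p.toSubgraph.Adj a y := by
    intro a b p hp ha hmax y hay
    by_cases hy : y ∈ p.support
    · rw [hF.eq_snd_of_adj_start hp hay hy]
      refine p.toSubgraph_adj_snd fun hnil => ?_
      cases hnil
      simp at hy
      exact hay.ne' hy
    · have := hmax y b (Walk.cons hay.symm p) ((Walk.cons_isPath_iff _ _).2 ⟨hp, hy⟩)
        (ha.trans hay.reachable)
      simp at this
  have hclosed : ∀ x ∈ p.support, ∀ y, F.Adj x y → p.toSubgraph.Adj x y := by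
    intro x hx y hxy
    obtain ⟨i, rfl, hi⟩ := Walk.mem_support_iff_exists_getVert.1 hx
    by_cases h0 : i = 0
    · subst h0
      simp only [Walk.getVert_zero] at hxy ⊢
      exact hstart p hp hva hmax y hxy
    by_cases h1 : i = p.length
    · subst h1
      simp only [Walk.getVert_length] at hxy ⊢
      rw [← p.toSubgraph_reverse]
      refine hstart p.reverse hp.reverse (hva.trans p.reachable) (fun a' b' q hq ha' => ?_) y hxy
      rw [Walk.length_reverse]
      exact hmax a' b' q hq ha'
    have h2 := hp.ncard_neighborSet_toSubgraph_internal_eq_two h0 (lt_of_le_of_ne hi h1)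
    obtain ⟨c, d, hcd, hset⟩ := Set.ncard_eq_two.1 h2
    have hc : p.toSubgraph.Adj (p.getVert i) c := by
      change c ∈ p.toSubgraph.neighborSet _
      simp [hset]
    have hd : p.toSubgraph.Adj (p.getVert i) d := by
      change d ∈ p.toSubgraph.neighborSet _
      simp [hset]
    rcases eq_or_eq_of_vertexDegree_le_two (hdeg _) hc.adj_sub hd.adj_sub hcd hxy with rfl | rfl
    exacts [hc, hd]
  have hreach : ∀ x, F.Reachable a x → x ∈ p.support := by
    rintro x ⟨q⟩
    have : ∀ {y z : V} (q : F.Walk y z), y ∈ p.support → z ∈ p.support := by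
      intro y z q
      induction q with
      | nil => exact id
      | cons h q ih =>
        exact fun hy => ih (p.mem_support_of_adj_toSubgraph (hclosed _ hy _ h).symm)
    exact this q p.start_mem_support
  refine ⟨a, b, p.mapLe hle, hp.mapLe hle, ?_⟩
  refine Subgraph.ext (Set.ext fun x => ?_) ?_
  · rw [Walk.mem_verts_toSubgraph]
    simp only [Walk.support_mapLe_eq_support, componentSubgraph, Set.mem_ofPred_eq]
    exact ⟨fun hx => hva.trans (p.takeUntil x hx).reachable, fun hx => hreach x (hva.symm.trans hx)⟩
  · ext x y
    rw [Walk.adj_toSubgraph_mapLe]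
    simp only [componentSubgraph]
    refine ⟨fun h => ⟨h.adj_sub, ?_⟩, fun h => hclosed x (hreach x (hva.symm.trans h.2)) y h.1⟩
    exact hva.trans (p.takeUntil x (p.mem_support_of_adj_toSubgraph h)).reachable

/-- Every spanning linear forest of an acyclic graph comes from a path cover. -/
theorem IsAcyclic.exists_isPathCover [Finite V] {F G : SimpleGraph V}
    (hG : G.IsAcyclic) (hle : F ≤ G) (hdeg : ∀ v, F.vertexDegree v ≤ 2) :
    ∃ C : Finset G.Subgraph, G.IsPathCover C ∧ coverGraph C = F := by
  classical
  have := Fintype.ofFinite V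
  refine ⟨Finset.univ.image (componentSubgraph hle), ⟨?_, fun v => ?_⟩, ?_⟩
  · intro P hP
    obtain ⟨v, -, rfl⟩ := Finset.mem_image.1 hP
    exact (hG.anti hle).exists_isPathBetween_componentSubgraph hle hdeg v
  · refine ⟨componentSubgraph hle v, ⟨by simp, Reachable.refl _⟩, ?_⟩
    rintro P ⟨hP, hv⟩
    obtain ⟨w, -, rfl⟩ := Finset.mem_image.1 hP
    have hwv : F.Reachable w v := hv
    refine Subgraph.ext (Set.ext fun x => ⟨hwv.symm.trans, hwv.trans⟩) ?_
    ext x y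
    exact and_congr_right fun _ => ⟨hwv.symm.trans, hwv.trans⟩
  · ext x y
    constructor
    · rintro ⟨P, hP, h⟩
      obtain ⟨w, -, rfl⟩ := Finset.mem_image.1 hP
      exact h.1
    · intro h
      exact ⟨componentSubgraph hle x, by simp, h, Reachable.refl _⟩

/-- The path cover number of an acyclic graph is at most the number of components of any spanning
linear forest `F`. -/
theorem IsAcyclic.pathCoverNumber_add_ncard_edgeSet_le [Finite V] {F G : SimpleGraph V}
    (hG : G.IsAcyclic) (hle : F ≤ G) (hdeg : ∀ v, F.vertexDegree v ≤ 2) :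
    G.pathCoverNumber + F.edgeSet.ncard ≤ Nat.card V := by
  obtain ⟨C, hC, rfl⟩ := hG.exists_isPathCover hle hdeg
  have h1 : G.pathCoverNumber ≤ C.card := Nat.sInf_le ⟨C, hC, rfl⟩
  have h2 := hC.ncard_edgeSet_add_card
  omega

theorem exists_isMinimumPathCover [Finite V] (G : SimpleGraph V) :
    ∃ C, G.IsMinimumPathCover C := by
  classical
  have := Fintype.ofFinite V
  have hne : {k | ∃ C : Finset G.Subgraph, G.IsPathCover C ∧ C.card = k}.Nonempty := by
    refine ⟨_, Finset.univ.image G.singletonSubgraph, ⟨?_, fun v => ?_⟩, rfl⟩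
    · intro P hP
      obtain ⟨v, -, rfl⟩ := Finset.mem_image.1 hP
      exact ⟨v, v, Walk.nil, by simp, rfl⟩
    · refine ⟨G.singletonSubgraph v, by simp, ?_⟩
      rintro P ⟨hP, hv⟩
      obtain ⟨w, -, rfl⟩ := Finset.mem_image.1 hP
      simp only [singletonSubgraph_verts, Set.mem_singleton_iff] at hv
      rw [hv]
  exact Nat.sInf_mem hne

/-! ### Bounds for the total forcing number by the path cover number -/

/-- Choose a vertex `r P` on every path `P` of a path cover. Together with a neighbor of each
`r P`, taken on `P` when possible, these vertices form a total forcing set. The neighbor can be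
spared for the paths `P` in `E`, for which `r P` is an end of `P` adjacent to another chosen
vertex. -/
theorem IsTree.totalForcingNumber_add_card_le [Finite V] [Nontrivial V] {T : SimpleGraph V}
    (hT : T.IsTree) {C E : Finset T.Subgraph} (hC : T.IsPathCover C) (hEC : E ⊆ C)
    (r : T.Subgraph → V) (hr : ∀ P ∈ C, r P ∈ P.verts)
    (hE : ∀ P ∈ E, (coverGraph C).vertexDegree (r P) ≤ 1 ∧ ∃ Q ∈ C, T.Adj (r P) (r Q)) :
    T.totalForcingNumber + E.card ≤ 2 * C.card := by
  classical
  set F := coverGraph C with hF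
  have hnb : ∀ v, ∃ w, T.Adj v w ∧ ((∃ x, F.Adj v x) → F.Adj v w) := fun v => by
    by_cases h : ∃ x, F.Adj v x
    · obtain ⟨x, hx⟩ := h
      exact ⟨x, coverGraph_le C hx, fun _ => hx⟩
    · obtain ⟨x, hx⟩ := hT.exists_adj v
      exact ⟨x, hx, fun h' => absurd h' h⟩
  choose nb hnbT hnbF using hnb
  -- The neighbors taken off their paths are only needed for totality, not for forcing.
  let S₀ : Set V := {v | (∃ P ∈ C, v = r P) ∨
    ∃ P ∈ C, P ∉ E ∧ F.Adj (r P) (nb (r P)) ∧ v = nb (r P)}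
  let S : Finset V := C.image r ∪ (C \ E).image fun P => nb (r P)
  have hS₀ : T.IsForcingSet S₀ := by
    refine hT.isAcyclic.isForcingSet (coverGraph_le C) (fun v => ?_) ?_
      fun v _ => hC.vertexDegree_le_two v
    · obtain ⟨P, hP, hv⟩ := hC.exists_mem v
      exact ⟨r P, Or.inl ⟨P, hP, rfl⟩, (hC.mem_verts_iff hP hv).1 (hr P hP)⟩
    · -- A vertex with an `F`-neighbor in `S₀` has at most one other `F`-neighbor.
      have aux : ∀ s x, x ∈ S₀ → F.Adj s x → ∀ a b, F.Adj s a → F.Adj s b → a ∉ S₀ → b ∉ S₀ →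
          a = b := by
        intro s x hx hsx a b ha hb haS hbS
        by_contra hab
        rcases eq_or_eq_of_vertexDegree_le_two (hC.vertexDegree_le_two s) ha hb hab hsx with h | h
        exacts [haS (h ▸ hx), hbS (h ▸ hx)]
      rintro s (⟨P, hP, rfl⟩ | ⟨P, hP, -, hadj, rfl⟩) a b ha hb
      · by_cases hPE : P ∈ E
        · exact fun _ _ => vertexDegree_le_one_iff.1 (hE P hPE).1 a b ha hb
        · have h := hnbF (r P) ⟨a, ha⟩
          exact aux _ _ (Or.inr ⟨P, hP, hPE, h, rfl⟩) h a b ha hb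
      · exact aux _ _ (Or.inl ⟨P, hP, rfl⟩) hadj.symm a b ha hb
  have hS : T.IsTotalForcingSet (S : Set V) := by
    refine ⟨hS₀.mono ?_, ?_⟩
    · rintro v (⟨P, hP, rfl⟩ | ⟨P, hP, hPE, -, rfl⟩)
      · exact Finset.mem_coe.2 (Finset.mem_union_left _ (Finset.mem_image_of_mem r hP))
      · exact Finset.mem_coe.2 (Finset.mem_union_right _
          (Finset.mem_image.2 ⟨P, Finset.mem_sdiff.2 ⟨hP, hPE⟩, rfl⟩))
    · intro v hv
      rcases Finset.mem_union.1 (Finset.mem_coe.1 hv) with hv | hv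
      · obtain ⟨P, hP, rfl⟩ := Finset.mem_image.1 hv
        by_cases hPE : P ∈ E
        · obtain ⟨Q, hQ, hPQ⟩ := (hE P hPE).2
          exact ⟨r Q, Finset.mem_coe.2 (Finset.mem_union_left _ (Finset.mem_image_of_mem r hQ)),
            hPQ⟩
        · exact ⟨nb (r P), Finset.mem_coe.2 (Finset.mem_union_right _
            (Finset.mem_image.2 ⟨P, Finset.mem_sdiff.2 ⟨hP, hPE⟩, rfl⟩)), hnbT _⟩
      · obtain ⟨P, hP, rfl⟩ := Finset.mem_image.1 hv
        exact ⟨r P, Finset.mem_coe.2 (Finset.mem_union_left _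
          (Finset.mem_image_of_mem r (Finset.mem_sdiff.1 hP).1)), (hnbT _).symm⟩
  have h1 := totalForcingNumber_le S.finite_toSet hS
  rw [Set.ncard_coe_finset] at h1
  have h2 : S.card ≤ C.card + (C \ E).card :=
    (Finset.card_union_le _ _).trans (add_le_add Finset.card_image_le Finset.card_image_le)
  have h3 := Finset.card_sdiff_add_card_eq_card hEC
  omega

theorem IsTree.totalForcingNumber_le_two_mul [Finite V] [Nontrivial V] {T : SimpleGraph V}
    (hT : T.IsTree) : T.totalForcingNumber ≤ 2 * T.pathCoverNumber := by
  classical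
  obtain ⟨C, hC, hcard⟩ := exists_isMinimumPathCover T
  have : ∀ P : T.Subgraph, ∃ v, P ∈ C → v ∈ P.verts := fun P => by
    by_cases hP : P ∈ C
    · obtain ⟨u, v, h⟩ := hC.1 P hP
      exact ⟨u, fun _ => h.left_mem⟩
    · exact ⟨Classical.arbitrary V, fun h => absurd h hP⟩
  choose r hr using this
  have := hT.totalForcingNumber_add_card_le hC (Finset.empty_subset C) r hr (by simp)
  simp at this
  omega

/-- If some vertex `v` is the end of its path in a minimum path cover, and an edge `vw` lies on no
path of the cover, then `F_t ≤ 2 pc - 1`: choosing `v` and `w` on their paths, no further vertex is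
needed for the path of `v`. -/
theorem IsTree.totalForcingNumber_lt_two_mul [Finite V] [Nontrivial V] {T : SimpleGraph V}
    (hT : T.IsTree) {C : Finset T.Subgraph} (hC : T.IsMinimumPathCover C) {v w : V}
    (hv : (coverGraph C).vertexDegree v ≤ 1) (hvw : T.Adj v w) (hF : ¬ (coverGraph C).Adj v w) :
    T.totalForcingNumber < 2 * T.pathCoverNumber := by
  classical
  obtain ⟨P, hP, hvP⟩ := hC.1.exists_mem v
  obtain ⟨Q, hQ, hwQ⟩ := hC.1.exists_mem w
  have hPQ : Q ≠ P := by
    rintro rfl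
    -- The path of the cover from `v` to `w` would have to be the edge `vw`.
    obtain ⟨p, hp⟩ := ((hC.1.mem_verts_iff hQ hvP).1 hwQ).exists_isPath
    have := hT.isAcyclic.eq_snd_of_adj_start (hp.mapLe (coverGraph_le C)) hvw
      (Walk.end_mem_support _)
    cases p with
    | nil => exact hvw.ne rfl
    | cons h q =>
      simp at this
      exact hF (this ▸ h)
  have : ∀ R : T.Subgraph, ∃ x, R ∈ C → x ∈ R.verts := fun R => by
    by_cases hR : R ∈ C
    · obtain ⟨x, y, h⟩ := hC.1.1 R hR
      exact ⟨x, fun _ => h.left_mem⟩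
    · exact ⟨v, fun h => absurd h hR⟩
  choose r hr using this
  let r' := Function.update (Function.update r P v) Q w
  have hrQ : r' Q = w := Function.update_self _ _ _
  have hrP : r' P = v := by
    rw [show r' P = Function.update r P v P from Function.update_of_ne hPQ.symm _ _,
      Function.update_self]
  have := hT.totalForcingNumber_add_card_le hC.1 (Finset.singleton_subset_iff.2 hP) r'
    (fun R hR => ?_) (fun R hR => ?_)
  · rw [Finset.card_singleton, hC.2] at this
    omega
  · by_cases h1 : R = Q
    · rw [h1, hrQ]
      exact hwQ
    by_cases h2 : R = P
    · rw [h2, hrP]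
      exact hvP
    · rw [show r' R = r R from (Function.update_of_ne h1 _ _).trans (Function.update_of_ne h2 _ _)]
      exact hr R hR
  · rw [Finset.mem_singleton.1 hR, hrP]
    exact ⟨hv, Q, hQ, hrQ.symm ▸ hvw⟩

namespace IsChronology

variable {T : SimpleGraph V} {S : Set V} {t : V → ℕ} {p : V → V}

theorem exists_forall_apply_eq (h : T.IsChronology S t p) (v : V) :
    ∃ c, ∀ w ∉ S, p w = v → w = c := by
  by_cases hc : ∃ c, c ∉ S ∧ p c = v
  · obtain ⟨c, hc, rfl⟩ := hc
    exact ⟨c, fun w hw hwc => h.injOn hw hc hwc⟩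
  · exact ⟨v, fun w hw hwv => absurd ⟨w, hw, hwv⟩ hc⟩

theorem injOn_edge (h : T.IsChronology S t p) : Set.InjOn (fun v => s(v, p v)) Sᶜ := by
  intro v hv w hw hvw
  rcases Sym2.eq_iff.1 hvw with ⟨h1, -⟩ | ⟨h1, h2⟩
  · exact h1
  · exact absurd (show p (p v) = v by rw [h2, h1]) (h.apply_apply_ne hv (h2 ▸ hw))

/-- The forcing chains started at `S`, joined by a matching `K` of edges inside `S`, form a
spanning linear forest of an acyclic graph. -/
theorem pathCoverNumber_add_ncard_edgeSet_le [Finite V] (hT : T.IsAcyclic)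
    (h : T.IsChronology S t p) {K : SimpleGraph V} (hKT : K ≤ T)
    (hKS : ∀ a b, K.Adj a b → a ∈ S) (hK : ∀ a b c, K.Adj a b → K.Adj a c → b = c) :
    T.pathCoverNumber + K.edgeSet.ncard ≤ S.ncard := by
  let F : SimpleGraph V := fromEdgeSet ((fun v => s(v, p v)) '' Sᶜ) ⊔ K
  have hF : ∀ a b, F.Adj a b → (a ∉ S ∧ b = p a) ∨ (b ∉ S ∧ p b = a) ∨ K.Adj a b := by
    intro a b hab
    rcases (sup_adj _ _ _ _).1 hab with hab | hab
    · obtain ⟨⟨v, hv, hvab⟩, -⟩ := (fromEdgeSet_adj _).1 hab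
      rcases Sym2.eq_iff.1 hvab with ⟨rfl, rfl⟩ | ⟨rfl, rfl⟩
      exacts [Or.inl ⟨hv, rfl⟩, Or.inr (Or.inl ⟨hv, rfl⟩)]
    · exact Or.inr (Or.inr hab)
  have hFT : F ≤ T := by
    intro a b hab
    rcases hF a b hab with ⟨ha, rfl⟩ | ⟨hb, rfl⟩ | hab
    exacts [(h.adj a ha).symm, h.adj b hb, hKT hab]
  have hdeg : ∀ v, F.vertexDegree v ≤ 2 := by
    intro v
    obtain ⟨c, hc⟩ := h.exists_forall_apply_eq v
    obtain ⟨d, hd⟩ : ∃ d, ∀ x, (v ∉ S ∧ x = p v) ∨ K.Adj v x → x = d := by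
      by_cases hv : v ∈ S
      · by_cases hK' : ∃ d, K.Adj v d
        · obtain ⟨d, hd⟩ := hK'
          exact ⟨d, fun x hx => hx.elim (fun h => absurd hv h.1) fun h => hK v x d h hd⟩
        · exact ⟨v, fun x hx => hx.elim (fun h => absurd hv h.1) fun h => absurd ⟨x, h⟩ hK'⟩
      · exact ⟨p v, fun x hx => hx.elim And.right fun h => absurd (hKS v x h) hv⟩
    refine vertexDegree_le_two_of_forall (a := c) (b := d) fun x hx => ?_
    rcases hF v x hx with hx | ⟨hx, hxv⟩ | hx
    exacts [Or.inr (hd x (Or.inl hx)), Or.inl (hc x hx hxv), Or.inr (hd x (Or.inr hx))]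
  have hE : Sᶜ.ncard + K.edgeSet.ncard ≤ F.edgeSet.ncard := by
    rw [← h.injOn_edge.ncard_image, ← Set.ncard_union_eq ?_ (Set.toFinite _)
      (Set.toFinite _)]
    · refine Set.ncard_le_ncard ?_ (Set.toFinite _)
      rintro e (⟨v, hv, rfl⟩ | he)
      · exact (sup_adj _ _ _ _).2 (Or.inl ((fromEdgeSet_adj _).2
          ⟨⟨v, hv, rfl⟩, (h.adj v hv).ne'⟩))
      · exact edgeSet_mono (le_sup_right : K ≤ F) he
    · refine Set.disjoint_left.2 ?_
      rintro _ ⟨v, hv, rfl⟩ he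
      exact hv (hKS _ _ he)
  have h1 := hT.pathCoverNumber_add_ncard_edgeSet_le hFT hdeg
  have h2 := Set.ncard_add_ncard_compl S
  omega

end IsChronology

theorem IsTree.pathCoverNumber_lt_totalForcingNumber [Finite V] [Nontrivial V]
    {T : SimpleGraph V} (hT : T.IsTree) : T.pathCoverNumber + 1 ≤ T.totalForcingNumber := by
  obtain ⟨S, hS, hcard⟩ := hT.exists_isTotalForcingSet
  obtain ⟨t, p, hp⟩ := hS.1.exists_isChronology
  obtain ⟨u, hu⟩ : S.Nonempty := by
    by_contra hne
    rw [Set.not_nonempty_iff_eq_empty] at hne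
    subst hne
    -- Without an initial vertex, a vertex colored first has no forcing vertex.
    obtain ⟨v, hv⟩ := Finite.exists_min t
    exact absurd (hv (p v)) (hp.lt v (Set.notMem_empty v)).not_ge
  obtain ⟨v, hv, huv⟩ := hS.2 u hu
  have := hp.pathCoverNumber_add_ncard_edgeSet_le hT.isAcyclic (K := edge u v) ?_ ?_ ?_
  · rw [edgeSet_edge_of_ne huv.ne, Set.ncard_singleton] at this
    omega
  · exact (edge_le_iff _).2 (Or.inr huv)
  · intro a b hab
    rw [edge_adj] at hab
    rcases hab.1 with ⟨rfl, rfl⟩ | ⟨rfl, rfl⟩ <;> assumption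
  · intro a b c hab hac
    rw [edge_adj] at hab hac
    grind

/-! ### Trees with the smallest total forcing number -/

theorem IsTree.vertexDegree_le_pathCoverNumber_add_one [Finite V] {T : SimpleGraph V}
    (hT : T.IsTree) (c : V) : T.vertexDegree c ≤ T.pathCoverNumber + 1 := by
  obtain ⟨C, hC, hcard⟩ := exists_isMinimumPathCover T
  have h1 := hC.ncard_edgeSet_add_card
  have h2 := hT.ncard_edgeSet
  have h3 : (coverGraph C).edgeSet.ncard +
      (T.neighborSet c \ (coverGraph C).neighborSet c).ncard ≤ T.edgeSet.ncard := by
    rw [← Set.ncard_image_of_injective (f := fun w => s(c, w)) _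
      (fun a b h => (Sym2.congr_right).1 h), ← Set.ncard_union_eq ?_ (Set.toFinite _)
      (Set.toFinite _)]
    · refine Set.ncard_le_ncard ?_ (Set.toFinite _)
      rintro e (he | ⟨w, hw, rfl⟩)
      exacts [edgeSet_mono (coverGraph_le C) he, hw.1]
    · refine Set.disjoint_right.2 ?_
      rintro _ ⟨w, hw, rfl⟩ he
      exact hw.2 he
  have h4 := Set.ncard_le_ncard_sdiff_add_ncard (T.neighborSet c) ((coverGraph C).neighborSet c)
  have h5 := hC.vertexDegree_le_two c
  unfold vertexDegree at h5 ⊢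
  omega

/-- A tree with at most one vertex `c` of degree three or more is forced by `c` and all but one of
its neighbors. -/
theorem IsTree.totalForcingNumber_le_of_vertexDegree_le [Finite V] [Nontrivial V]
    {T : SimpleGraph V} (hT : T.IsTree) {c : V} (hc : ∀ w ≠ c, T.vertexDegree w ≤ 2) :
    T.totalForcingNumber ≤ max 2 (T.vertexDegree c) := by
  have key : ∀ N ⊆ T.neighborSet c, N.Nonempty →
      (∀ a b, T.Adj c a → T.Adj c b → a ∉ N → b ∉ N → a = b) →
      T.totalForcingNumber ≤ N.ncard + 1 := by
    rintro N hN ⟨z, hz⟩ hN1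
    refine (totalForcingNumber_le (Set.toFinite (insert c N)) ⟨?_, ?_⟩).trans
      (Set.ncard_insert_le _ _)
    · refine hT.isAcyclic.isForcingSet le_rfl
        (fun v => ⟨c, Set.mem_insert _ _, hT.connected.preconnected v c⟩) ?_
        fun v hv => hc v fun h => hv (h ▸ Set.mem_insert _ _)
      intro s hs a b ha hb haS hbS
      simp only [Set.mem_insert_iff, not_or] at haS hbS
      by_cases hsc : s = c
      · subst hsc
        exact hN1 a b ha hb haS.2 hbS.2
      · have hs' : T.Adj s c := (hN (hs.resolve_left hsc)).symm
        by_contra hab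
        rcases eq_or_eq_of_vertexDegree_le_two (hc s hsc) ha hb hab hs' with h | h
        exacts [haS.1 h.symm, hbS.1 h.symm]
    · rintro v (rfl | hv)
      · exact ⟨z, Set.mem_insert_of_mem _ hz, hN hz⟩
      · exact ⟨c, Set.mem_insert _ _, (hN hv).symm⟩
  obtain ⟨y, hy⟩ := hT.exists_adj c
  have hcard : (T.neighborSet c \ {y}).ncard + 1 = (T.neighborSet c).ncard :=
    Set.ncard_sdiff_singleton_add_one hy (Set.toFinite _)
  by_cases hz : (T.neighborSet c \ {y}).Nonempty
  · have := key _ Set.sdiff_subset hz fun a b ha hb haN hbN => by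
      have h1 : a = y := by
        by_contra h
        exact haN ⟨ha, h⟩
      have h2 : b = y := by
        by_contra h
        exact hbN ⟨hb, h⟩
      rw [h1, h2]
    exact le_max_of_le_right (this.trans hcard.le)
  · have := key _ subset_rfl ⟨y, hy⟩ fun a b ha _ haN => absurd ha haN
    rw [Set.not_nonempty_iff_eq_empty] at hz
    rw [hz, Set.ncard_empty] at hcard
    exact le_max_of_le_left (by omega)

/-- If any two edges inside `S` meet and no vertex of `S` is isolated in `S`, then some vertex of
`S` is adjacent to all others. In an acyclic graph this means that `S` spans a star. -/
theorem exists_forall_adj_of_edges_meet {G : SimpleGraph V} {S : Set V} (hne : S.Nonempty)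
    (hS : ∀ v ∈ S, ∃ w ∈ S, G.Adj v w)
    (hmeet : ∀ a ∈ S, ∀ b ∈ S, ∀ c ∈ S, ∀ d ∈ S, G.Adj a b → G.Adj c d →
      a = c ∨ a = d ∨ b = c ∨ b = d) :
    ∃ c ∈ S, ∀ x ∈ S, x ≠ c → G.Adj x c := by
  obtain ⟨u, hu⟩ := hne
  obtain ⟨v, hv, huv⟩ := hS u hu
  by_cases hstar : ∀ x ∈ S, x ≠ u → G.Adj x u
  · exact ⟨u, hu, hstar⟩
  push Not at hstar
  obtain ⟨x₀, hx₀, hx₀u, hnadj⟩ := hstar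
  have hx₀v : G.Adj x₀ v := by
    obtain ⟨y, hy, hadj⟩ := hS x₀ hx₀
    rcases hmeet u hu v hv x₀ hx₀ y hy huv hadj with h | h | h | h
    · exact absurd h.symm hx₀u
    · exact absurd (h ▸ hadj) hnadj
    · exact absurd (h ▸ huv.symm) hnadj
    · exact h ▸ hadj
  refine ⟨v, hv, fun x hx hxv => ?_⟩
  obtain ⟨z, hz, hadj⟩ := hS x hx
  have h1 := hmeet u hu v hv x hx z hz huv hadj
  have h2 := hmeet x₀ hx₀ v hv x hx z hz hx₀v hadj
  by_cases hzv : z = v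
  · exact hzv ▸ hadj
  · rcases h1 with h | h | h | h
    · exact h ▸ huv
    · rcases h2 with h' | h' | h' | h'
      · exact h' ▸ hx₀v
      · exact absurd (h'.trans h.symm) hx₀u
      · exact absurd h'.symm hxv
      · exact absurd h'.symm hzv
    · exact absurd h.symm hxv
    · exact absurd h.symm hzv

/-- If a forcing set `S` of a tree spans a star with center `c`, then the edges of the star and the
edges used for forcing are all the edges of the tree, by counting. Hence every vertex other than
`c` has degree at most two. -/
theorem IsChronology.vertexDegree_le_two [Finite V] {T : SimpleGraph V} {S : Set V} {t : V → ℕ}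
    {p : V → V} (h : T.IsChronology S t p) (hT : T.IsTree) {c : V} (hc : c ∈ S)
    (hstar : ∀ x ∈ S, x ≠ c → T.Adj x c) {w : V} (hw : w ≠ c) : T.vertexDegree w ≤ 2 := by
  classical
  let g : V → Sym2 V := fun v => if v ∈ S then s(v, c) else s(v, p v)
  have hgS : ∀ v ∈ S, g v = s(v, c) := fun v hv => if_pos hv
  have hgN : ∀ v ∉ S, g v = s(v, p v) := fun v hv => if_neg hv
  have hinj : Set.InjOn g {c}ᶜ := by
    have mixed : ∀ v ∈ S, ∀ w ∉ S, g v ≠ g w := by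
      intro v hv w hw heq
      rw [hgS v hv, hgN w hw] at heq
      rcases Sym2.eq_iff.1 heq with ⟨rfl, -⟩ | ⟨-, rfl⟩
      exacts [hw hv, hw hc]
    intro v hv w hw heq
    by_cases hvS : v ∈ S <;> by_cases hwS : w ∈ S
    · rw [hgS v hvS, hgS w hwS] at heq
      exact Sym2.congr_left.1 heq
    · exact absurd heq (mixed v hvS w hwS)
    · exact absurd heq.symm (mixed w hwS v hvS)
    · rw [hgN v hvS, hgN w hwS] at heq
      exact h.injOn_edge hvS hwS heq
  have hsub : g '' {c}ᶜ ⊆ T.edgeSet := by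
    rintro _ ⟨v, hv, rfl⟩
    by_cases hvS : v ∈ S
    · rw [hgS v hvS]
      exact hstar v hvS hv
    · rw [hgN v hvS]
      exact (h.adj v hvS).symm
  have himage : g '' {c}ᶜ = T.edgeSet := by
    refine Set.eq_of_subset_of_ncard_le hsub ?_ (Set.toFinite _)
    rw [hinj.ncard_image]
    have h1 := Set.ncard_add_ncard_compl {c}
    rw [Set.ncard_singleton] at h1
    have h2 := hT.ncard_edgeSet
    omega
  obtain ⟨d, hd⟩ := h.exists_forall_apply_eq w
  refine vertexDegree_le_two_of_forall (a := if w ∈ S then c else p w) (b := d) fun x hx => ?_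
  have hx' : s(w, x) ∈ g '' {c}ᶜ := himage ▸ hx
  obtain ⟨v, hv, heq⟩ := hx'
  by_cases hvS : v ∈ S
  · rw [hgS v hvS] at heq
    rcases Sym2.eq_iff.1 heq with ⟨rfl, rfl⟩ | ⟨-, rfl⟩
    · exact Or.inl (if_pos hvS).symm
    · exact absurd rfl hw
  · rw [hgN v hvS] at heq
    rcases Sym2.eq_iff.1 heq with ⟨rfl, rfl⟩ | ⟨rfl, hpv⟩
    · exact Or.inl (if_neg hvS).symm
    · exact Or.inr (hd v hvS hpv)

/-- The total forcing number of a tree is `pc + 1` exactly when at most one vertex has degree three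
or more. -/
theorem IsTree.totalForcingNumber_eq_pathCoverNumber_add_one_iff [Finite V] [Nontrivial V]
    {T : SimpleGraph V} (hT : T.IsTree) :
    T.totalForcingNumber = T.pathCoverNumber + 1 ↔ ∃ c, ∀ w ≠ c, T.vertexDegree w ≤ 2 := by
  have hlow := hT.pathCoverNumber_lt_totalForcingNumber
  constructor
  · intro heq
    obtain ⟨S, hS, hcard⟩ := hT.exists_isTotalForcingSet
    obtain ⟨t, p, hp⟩ := hS.1.exists_isChronology
    have hne : S.Nonempty := by
      rw [← Set.ncard_pos (Set.toFinite _)]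
      omega
    obtain ⟨c, hc, hstar⟩ := exists_forall_adj_of_edges_meet (G := T) hne hS.2 (by
      intro a ha b hb c hc d hd hab hcd
      by_contra! hdis
      obtain ⟨h1, h2, h3, h4⟩ := hdis
      have hadj : ∀ x y, (fromEdgeSet {s(a, b), s(c, d)}).Adj x y → (x = a ∧ y = b) ∨
          (x = b ∧ y = a) ∨ (x = c ∧ y = d) ∨ (x = d ∧ y = c) := by
        intro x y hxy
        simp only [fromEdgeSet_adj, Set.mem_insert_iff, Set.mem_singleton_iff,
          Sym2.eq_iff] at hxy
        tauto
      have := hp.pathCoverNumber_add_ncard_edgeSet_le hT.isAcyclic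
        (K := fromEdgeSet {s(a, b), s(c, d)}) ?_ ?_ ?_
      · have hE : (fromEdgeSet {s(a, b), s(c, d)}).edgeSet = {s(a, b), s(c, d)} := by
          rw [edgeSet_fromEdgeSet, sdiff_eq_left, Set.disjoint_left]
          rintro e (rfl | rfl) he
          exacts [hab.ne (by simpa using he), hcd.ne (by simpa using he)]
        rw [hE, Set.ncard_pair] at this
        · omega
        · intro h
          rcases Sym2.eq_iff.1 h with h | h
          exacts [h1 h.1, h2 h.1]
      · intro x y hxy
        rcases hadj x y hxy with ⟨rfl, rfl⟩ | ⟨rfl, rfl⟩ | ⟨rfl, rfl⟩ | ⟨rfl, rfl⟩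
        exacts [hab, hab.symm, hcd, hcd.symm]
      · intro x y hxy
        rcases hadj x y hxy with ⟨rfl, rfl⟩ | ⟨rfl, rfl⟩ | ⟨rfl, rfl⟩ | ⟨rfl, rfl⟩ <;> assumption
      · intro x y z hxy hxz
        have h5 := hadj x y hxy
        have h6 := hadj x z hxz
        have h7 := hab.ne
        have h8 := hcd.ne
        grind)
    exact ⟨c, fun w hw => hp.vertexDegree_le_two hT hc hstar hw⟩
  · rintro ⟨c, hc⟩
    have h1 := hT.totalForcingNumber_le_of_vertexDegree_le hc
    have h2 := hT.vertexDegree_le_pathCoverNumber_add_one c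
    have h3 := hT.totalForcingNumber_le_two_mul
    rcases le_max_iff.1 h1 with h | h <;> omega

/-! ### Trees with the largest total forcing number -/

/-- Two linear forests `F`, `F'` in an acyclic graph `T`, both of which contain all the edges of
`T` at each vertex where their degree is less than two, coincide: their symmetric difference has no
vertex of degree one. -/
theorem IsAcyclic.eq_of_saturated [Finite V] {T F F' : SimpleGraph V} (hT : T.IsAcyclic)
    (hF : F ≤ T) (hF' : F' ≤ T) (hd : ∀ v, F.vertexDegree v ≤ 2)
    (hd' : ∀ v, F'.vertexDegree v ≤ 2)
    (hs : ∀ v w, F.vertexDegree v ≤ 1 → T.Adj v w → F.Adj v w)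
    (hs' : ∀ v w, F'.vertexDegree v ≤ 1 → T.Adj v w → F'.Adj v w) : F = F' := by
  have step : ∀ {F F' : SimpleGraph V}, F ≤ T → (∀ v, F.vertexDegree v ≤ 2) →
      (∀ v w, F'.vertexDegree v ≤ 1 → T.Adj v w → F'.Adj v w) →
      ∀ a b, F.Adj a b → ¬ F'.Adj a b → ∃ c, c ≠ a ∧ F'.Adj b c ∧ ¬ F.Adj b c := by
    intro F F' hF hd hs' a b hab hnab
    by_contra! hcon
    refine hnab (hs' b a ?_ (hF hab).symm).symm
    rw [vertexDegree_le_one_iff]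
    intro x y hx hy
    have hxa : x ≠ a := fun h => hnab (h ▸ hx.symm)
    have hya : y ≠ a := fun h => hnab (h ▸ hy.symm)
    rcases eq_or_ne x y with h | hxy
    · exact h
    · exact ((eq_or_eq_of_vertexDegree_le_two (hd b) (hcon x hxa hx) (hcon y hya hy) hxy
        hab.symm).elim (fun h => absurd h.symm hxa) fun h => absurd h.symm hya)
  have key := hT.not_dart_of_continues
    (D := fun a b => (F.Adj a b ∧ ¬ F'.Adj a b) ∨ (F'.Adj a b ∧ ¬ F.Adj a b))
    (by
      rintro a b (h | h)
      exacts [hF h.1, hF' h.1])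
    (by
      rintro a b (h | h)
      · obtain ⟨c, hca, hc⟩ := step hF hd hs' a b h.1 h.2
        exact ⟨c, hca, Or.inr hc⟩
      · obtain ⟨c, hca, hc⟩ := step hF' hd' hs a b h.1 h.2
        exact ⟨c, hca, Or.inl hc⟩)
  ext a b
  have := key a b
  tauto

theorem IsTree.totalForcingNumber_eq_two_mul_iff [Finite V] [Nontrivial V]
    {T : SimpleGraph V} (hT : T.IsTree) :
    T.totalForcingNumber = 2 * T.pathCoverNumber ↔
      ∃ C : Finset T.Subgraph, T.IsMinimumPathCover C ∧
        (∀ D : Finset T.Subgraph, T.IsMinimumPathCover D → D = C) ∧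
        ∀ P ∈ C, ∃ u v : V, u ≠ v ∧ T.IsLeafVertex u ∧ T.IsLeafVertex v ∧
          T.IsPathBetween P u v := by
  classical
  constructor
  · intro heq
    have hsat : ∀ D, T.IsMinimumPathCover D → ∀ v w, (coverGraph D).vertexDegree v ≤ 1 →
        T.Adj v w → (coverGraph D).Adj v w := by
      intro D hD v w hv hvw
      by_contra hF
      exact (hT.totalForcingNumber_lt_two_mul hD hv hvw hF).ne heq
    obtain ⟨C, hC⟩ := exists_isMinimumPathCover T
    refine ⟨C, hC, fun D hD => ?_, fun P hP => ?_⟩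
    · exact hD.1.eq_of_coverGraph_eq hC.1 <| hT.isAcyclic.eq_of_saturated (coverGraph_le D)
        (coverGraph_le C) hD.1.vertexDegree_le_two hC.1.vertexDegree_le_two (hsat D hD) (hsat C hC)
    · have hend : ∀ u v, T.IsPathBetween P u v → T.IsLeafVertex u ∧ ∃ x, P.Adj u x := by
        intro u v huv
        have hdeg : (coverGraph C).vertexDegree u ≤ 1 := by
          rw [vertexDegree_le_one_iff]
          intro a b ha hb
          rw [hC.1.coverGraph_adj_iff hP huv.left_mem] at ha hb
          exact huv.eq_of_adj_left ha hb
        obtain ⟨x, hx⟩ := hT.exists_adj u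
        refine ⟨le_antisymm ?_ (vertexDegree_pos_iff.2 ⟨x, hx⟩), x,
          (hC.1.coverGraph_adj_iff hP huv.left_mem).1 (hsat C hC u x hdeg hx)⟩
        exact le_trans (Set.ncard_le_ncard (fun y hy => hsat C hC u y hdeg hy) (Set.toFinite _))
          hdeg
      obtain ⟨u, v, huv⟩ := hC.1.1 P hP
      refine ⟨u, v, ?_, (hend u v huv).1, (hend v u huv.symm).1, huv⟩
      rintro rfl
      obtain ⟨x, hx⟩ := (hend u u huv).2
      obtain ⟨p, hp, rfl⟩ := huv
      exact p.not_nil_of_adj_toSubgraph hx (Walk.isPath_iff_nil.1 hp)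
  · rintro ⟨C, hC, -, hends⟩
    have hle := hT.ncard_isLeafVertex_le_totalForcingNumber
    have hup := hT.totalForcingNumber_le_two_mul
    -- The ends of the paths of the cover are `2 pc` distinct leaves.
    suffices 2 * C.card ≤ {v | T.IsLeafVertex v}.ncard by
      rw [hC.2] at this
      omega
    have : ∀ P : T.Subgraph, ∃ u v : V, P ∈ C → u ≠ v ∧ T.IsLeafVertex u ∧ T.IsLeafVertex v ∧
        T.IsPathBetween P u v := fun P => by
      by_cases hP : P ∈ C
      · obtain ⟨u, v, h⟩ := hends P hP
        exact ⟨u, v, fun _ => h⟩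
      · exact ⟨Classical.arbitrary V, Classical.arbitrary V, fun h => absurd h hP⟩
    choose u v huv using this
    have hdisj : (C : Set T.Subgraph).PairwiseDisjoint fun P => ({u P, v P} : Finset V) := by
      intro P hP Q hQ hne
      have hmem : ∀ R ∈ C, ∀ x ∈ ({u R, v R} : Finset V), x ∈ R.verts := by
        intro R hR x hx
        rcases Finset.mem_insert.1 hx with rfl | hx
        · exact (huv R hR).2.2.2.left_mem
        · exact Finset.mem_singleton.1 hx ▸ (huv R hR).2.2.2.right_mem
      exact Finset.disjoint_left.2 fun x hx hx' =>
        hne (hC.1.eq_of_mem hP hQ (hmem P hP x hx) (hmem Q hQ x hx'))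
    have hcard : (C.biUnion fun P => ({u P, v P} : Finset V)).card = 2 * C.card := by
      rw [Finset.card_biUnion hdisj, Finset.sum_congr rfl fun P hP =>
        Finset.card_pair (huv P hP).1, Finset.sum_const, smul_eq_mul, mul_comm]
    rw [← hcard, ← Set.ncard_coe_finset]
    refine Set.ncard_le_ncard (fun x hx => ?_) (Set.toFinite _)
    obtain ⟨P, hP, hx⟩ := Finset.mem_biUnion.1 (Finset.mem_coe.1 hx)
    rcases Finset.mem_insert.1 hx with rfl | hx
    · exact (huv P hP).2.1
    · exact Finset.mem_singleton.1 hx ▸ (huv P hP).2.2.1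

/-! ### Trimming -/

theorem IsTrimmableEdge.vertexDegree_le_two {G : SimpleGraph V} {x y : V}
    (h : G.IsTrimmableEdge x y) : G.vertexDegree x ≤ 2 ∧ G.vertexDegree y ≤ 2 := by
  rcases h.2 with h | h <;> omega

/-- In a tree, both ends of an edge have no common neighbor. -/
theorem IsAcyclic.not_adj_of_adj_of_adj {T : SimpleGraph V} (hT : T.IsAcyclic) {a b c : V}
    (hab : T.Adj a b) (hbc : T.Adj b c) : ¬ T.Adj a c := by
  classical
  intro hac
  refine hT.cliqueFree (le_refl 3) {a, b, c} ?_
  rw [is3Clique_triple_iff]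
  exact ⟨hab, hac, hbc⟩

section contractEdge

variable {G : SimpleGraph V} {x y : V}

open Classical in
/-- The vertex map `V → V \ {y}` of the contraction of the edge `xy`: it sends `y` to `x`. -/
noncomputable def contractMap (hxy : x ≠ y) (v : V) : {v : V // v ≠ y} :=
  if h : v = y then ⟨x, hxy⟩ else ⟨v, h⟩

theorem contractMap_self (hxy : x ≠ y) : contractMap hxy y = ⟨x, hxy⟩ := dif_pos rfl

theorem contractMap_of_ne (hxy : x ≠ y) {v : V} (h : v ≠ y) : contractMap hxy v = ⟨v, h⟩ :=
  dif_neg h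

theorem contractMap_coe (hxy : x ≠ y) (a : {v : V // v ≠ y}) : contractMap hxy a = a :=
  contractMap_of_ne hxy a.2

theorem contractMap_adj_or_eq (hxy : x ≠ y) {a b : V} (hab : G.Adj a b) :
    (G.contractEdge x y).Adj (contractMap hxy a) (contractMap hxy b) ∨
      contractMap hxy a = contractMap hxy b := by
  by_cases heq : contractMap hxy a = contractMap hxy b
  · exact Or.inr heq
  · refine Or.inl ⟨heq, ?_⟩
    by_cases ha : a = y <;> by_cases hb : b = y
    · exact absurd (ha.trans hb.symm) hab.ne
    · subst ha
      rw [contractMap_self, contractMap_of_ne hxy hb]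
      exact Or.inr (Or.inl ⟨rfl, hab⟩)
    · subst hb
      rw [contractMap_self, contractMap_of_ne hxy ha]
      exact Or.inr (Or.inr ⟨rfl, hab⟩)
    · rw [contractMap_of_ne hxy ha, contractMap_of_ne hxy hb]
      exact Or.inl hab

/-- Every edge of the contraction comes from an edge other than `xy`. -/
theorem exists_of_contractEdge_adj (hxy : x ≠ y) {a b : {v : V // v ≠ y}}
    (h : (G.contractEdge x y).Adj a b) :
    ∃ a' b', G.Adj a' b' ∧ s(a', b') ≠ s(x, y) ∧ contractMap hxy a' = a ∧
      contractMap hxy b' = b := by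
  obtain ⟨hne, h | ⟨ha, h⟩ | ⟨hb, h⟩⟩ := h
  · refine ⟨a, b, h, fun heq => ?_, contractMap_coe _ _, contractMap_coe _ _⟩
    rcases Sym2.eq_iff.1 heq with ⟨-, h⟩ | ⟨h, -⟩
    exacts [b.2 h, a.2 h]
  · refine ⟨y, b, h, fun heq => ?_, ?_, contractMap_coe _ _⟩
    · rcases Sym2.eq_iff.1 heq with ⟨-, h⟩ | ⟨-, h⟩
      exacts [b.2 h, hne (Subtype.ext (ha.trans h.symm))]
    · rw [contractMap_self]
      exact Subtype.ext ha.symm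
  · refine ⟨a, y, h, fun heq => ?_, contractMap_coe _ _, ?_⟩
    · rcases Sym2.eq_iff.1 heq with ⟨h, -⟩ | ⟨h, -⟩
      exacts [hne (Subtype.ext (h.trans hb.symm)), a.2 h]
    · rw [contractMap_self]
      exact Subtype.ext hb.symm

theorem card_contractEdge [Finite V] : Nat.card {v : V // v ≠ y} + 1 = Nat.card V := by
  have h := Set.ncard_add_ncard_compl {y}
  rw [Set.ncard_singleton] at h
  have h2 : Nat.card {v : V // v ≠ y} = ({y}ᶜ : Set V).ncard := rfl
  omega

theorem IsTree.contractEdge [Finite V] (hG : G.IsTree) (hxy : G.Adj x y) :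
    (G.contractEdge x y).IsTree := by
  have hne := hxy.ne
  have hconn : (G.contractEdge x y).Connected := by
    have : Nonempty {v : V // v ≠ y} := ⟨⟨x, hne⟩⟩
    refine ⟨fun a b => ?_⟩
    have key : ∀ {a b : V}, G.Walk a b →
        (G.contractEdge x y).Reachable (contractMap hne a) (contractMap hne b) := by
      intro a b p
      induction p with
      | nil => exact Reachable.refl _
      | cons h q ih =>
        rcases contractMap_adj_or_eq hne h with h | h
        · exact h.reachable.trans ih
        · exact h ▸ ih
    obtain ⟨p⟩ := hG.connected.preconnected (a : V) b
    simpa only [contractMap_coe] using key p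
  refine isTree_iff_connected_and_card.2
    ⟨hconn, le_antisymm ?_ hconn.card_vert_le_card_edgeSet_add_one⟩
  have h1 : (G.contractEdge x y).edgeSet ⊆
      Sym2.map (contractMap hne) '' (G.edgeSet \ {s(x, y)}) := by
    intro e he
    induction e with | h a b =>
    obtain ⟨a', b', hadj, hne', rfl, rfl⟩ := exists_of_contractEdge_adj hne he
    exact ⟨s(a', b'), ⟨hadj, hne'⟩, rfl⟩
  have h2 := (Set.ncard_le_ncard h1 (Set.toFinite _)).trans (Set.ncard_image_le (Set.toFinite _))
  have h3 := Set.ncard_sdiff_singleton_add_one (show s(x, y) ∈ G.edgeSet from hxy) (Set.toFinite _)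
  have h4 := hG.ncard_edgeSet
  have h5 := card_contractEdge (V := V) (y := y)
  have h6 : Nat.card (G.contractEdge x y).edgeSet = (G.contractEdge x y).edgeSet.ncard := rfl
  omega

/-- Contracting an edge of a tree does not change the degrees of the other vertices. -/
theorem IsAcyclic.vertexDegree_contractEdge [Finite V] (hG : G.IsAcyclic) (hxy : G.Adj x y)
    {a : {v : V // v ≠ y}} (ha : (a : V) ≠ x) :
    (G.contractEdge x y).vertexDegree a = G.vertexDegree a := by
  have hinj : Set.InjOn (contractMap hxy.ne) (G.neighborSet a) := by
    intro v hv w hw heq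
    by_cases hvy : v = y <;> by_cases hwy : w = y
    · rw [hvy, hwy]
    · subst hvy
      rw [contractMap_self, contractMap_of_ne _ hwy] at heq
      have hxw : x = w := congrArg Subtype.val heq
      subst hxw
      exact absurd hw (hG.not_adj_of_adj_of_adj hv hxy.symm)
    · subst hwy
      rw [contractMap_self, contractMap_of_ne _ hvy] at heq
      have hvx : v = x := congrArg Subtype.val heq
      subst hvx
      exact absurd hw (hG.not_adj_of_adj_of_adj hv hxy)
    · rw [contractMap_of_ne _ hvy, contractMap_of_ne _ hwy] at heq
      exact congrArg Subtype.val heq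
  unfold vertexDegree
  rw [← hinj.ncard_image]
  congr 1
  ext b
  constructor
  · rintro ⟨-, h | ⟨h, -⟩ | ⟨hb, h⟩⟩
    · exact ⟨b, h, contractMap_coe _ _⟩
    · exact absurd h ha
    · exact ⟨y, h, by rw [contractMap_self]; exact Subtype.ext hb.symm⟩
  · rintro ⟨v, hv, rfl⟩
    have h := contractMap_adj_or_eq hxy.ne hv
    rw [contractMap_coe] at h
    refine h.resolve_right fun heq => ?_
    by_cases hvy : v = y
    · subst hvy
      rw [contractMap_self] at heq
      exact ha (congrArg Subtype.val heq)
    · rw [contractMap_of_ne _ hvy] at heq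
      exact (G.ne_of_adj hv) (congrArg Subtype.val heq)

/-- The vertex arising from the contraction of `xy` has degree at most `deg x + deg y - 2`. -/
theorem vertexDegree_contractEdge_add_two_le [Finite V] (hxy : G.Adj x y) :
    (G.contractEdge x y).vertexDegree ⟨x, hxy.ne⟩ + 2 ≤ G.vertexDegree x + G.vertexDegree y := by
  have h1 : (G.contractEdge x y).neighborSet ⟨x, hxy.ne⟩ ⊆
      contractMap hxy.ne '' ((G.neighborSet x \ {y}) ∪ (G.neighborSet y \ {x})) := by
    rintro b ⟨hne, h | ⟨-, h⟩ | ⟨hb, -⟩⟩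
    · exact ⟨b, Or.inl ⟨h, b.2⟩, contractMap_coe _ _⟩
    · exact ⟨b, Or.inr ⟨h, fun h' => hne (Subtype.ext h'.symm)⟩, contractMap_coe _ _⟩
    · exact absurd (Subtype.ext hb.symm) hne
  have h2 := (Set.ncard_le_ncard h1 (Set.toFinite _)).trans
    ((Set.ncard_image_le (Set.toFinite _)).trans (Set.ncard_union_le _ _))
  have h3 := Set.ncard_sdiff_singleton_add_one (show y ∈ G.neighborSet x from hxy) (Set.toFinite _)
  have h4 := Set.ncard_sdiff_singleton_add_one (show x ∈ G.neighborSet y from hxy.symm)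
    (Set.toFinite _)
  unfold vertexDegree
  omega

end contractEdge

/-- Contracting a trimmable edge of a tree neither creates nor destroys vertices of degree three or
more. -/
theorem IsTree.exists_vertexDegree_le_two_contractEdge_iff [Finite V] {G : SimpleGraph V}
    (hG : G.IsTree) {x y : V} (hxy : G.IsTrimmableEdge x y) :
    (∃ c, ∀ w ≠ c, (G.contractEdge x y).vertexDegree w ≤ 2) ↔
      ∃ c, ∀ w ≠ c, G.vertexDegree w ≤ 2 := by
  obtain ⟨hx, hy⟩ := hxy.vertexDegree_le_two
  have hz := vertexDegree_contractEdge_add_two_le hxy.1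
  have hother := fun a ha => hG.isAcyclic.vertexDegree_contractEdge hxy.1 (a := a) ha
  constructor
  · rintro ⟨c, hc⟩
    refine ⟨c, fun w hw => ?_⟩
    by_cases hwy : w = y
    · exact hwy ▸ hy
    by_cases hwx : w = x
    · exact hwx ▸ hx
    rw [← hother ⟨w, hwy⟩ hwx]
    exact hc _ fun h => hw (congrArg Subtype.val h)
  · rintro ⟨c, hc⟩
    have key : ∀ w : {v : V // v ≠ y}, (w : V) ≠ c → (G.contractEdge x y).vertexDegree w ≤ 2 := by
      intro w hw
      by_cases hwx : (w : V) = x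
      · obtain rfl : w = ⟨x, hxy.1.ne⟩ := Subtype.ext hwx
        omega
      · rw [hother w hwx]
        exact hc _ hw
    by_cases hcy : c = y
    · exact ⟨⟨x, hxy.1.ne⟩, fun w _ => key w fun h => w.2 (h.trans hcy)⟩
    · exact ⟨⟨c, hcy⟩, fun w hw => key w fun h => hw (Subtype.ext h)⟩

theorem Iso.vertexDegree_eq {W : Type w} {G : SimpleGraph V} {H : SimpleGraph W} (e : G ≃g H)
    (v : V) : H.vertexDegree (e v) = G.vertexDegree v := by
  unfold vertexDegree
  have : H.neighborSet (e v) = e '' G.neighborSet v := by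
    ext x
    constructor
    · intro hx
      refine ⟨e.symm x, ?_, e.apply_symm_apply x⟩
      rw [mem_neighborSet, ← e.map_adj_iff, e.apply_symm_apply]
      exact hx
    · rintro ⟨y, hy, rfl⟩
      exact e.map_adj_iff.2 hy
  rw [this, Set.ncard_image_of_injective _ e.injective]

/-- If all vertices other than `c` are leaves of a connected graph, then they are all adjacent
to `c`. -/
theorem Connected.adj_of_forall_vertexDegree_le_one [Finite V] {G : SimpleGraph V}
    (hG : G.Connected) {c : V} (hc : ∀ w ≠ c, G.vertexDegree w ≤ 1) {w : V} (hw : w ≠ c) :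
    G.Adj w c := by
  obtain ⟨p, hp⟩ := (hG.preconnected w c).exists_isPath
  cases p with
  | nil => exact absurd rfl hw
  | @cons _ z _ h q =>
    by_cases hz : z = c
    · exact hz ▸ h
    · cases q with
      | nil => exact absurd rfl hz
      | @cons _ z' _ h' q' =>
        -- The second vertex of the path would be a leaf with two neighbors on the path.
        have := vertexDegree_le_one_iff.1 (hc z hz) _ _ h.symm h'
        subst this
        simp at hp

/-- A connected graph all of whose vertices other than `c` are leaves is a star. -/
theorem Connected.nonempty_iso_completeBipartiteGraph [Finite V] {G : SimpleGraph V}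
    (hG : G.Connected) {c : V} (hc : ∀ w ≠ c, G.vertexDegree w ≤ 1) :
    Nonempty (G ≃g completeBipartiteGraph (Fin 1) (Fin (Nat.card V - 1))) := by
  classical
  have hadj := fun w hw => hG.adj_of_forall_vertexDegree_le_one hc (w := w) hw
  have hcard : Nat.card {v : V // v ≠ c} = Nat.card V - 1 := by
    have := card_contractEdge (V := V) (y := c)
    omega
  let e₁ : V ≃ {v : V // v = c} ⊕ {v : V // v ≠ c} := (Equiv.sumCompl (· = c)).symm
  let e₂ : {v : V // v = c} ≃ Fin 1 := Equiv.ofUnique _ _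
  let e₃ : {v : V // v ≠ c} ≃ Fin (Nat.card V - 1) := Finite.equivFinOfCardEq hcard
  refine ⟨⟨e₁.trans (Equiv.sumCongr e₂ e₃), fun {a b} => ?_⟩⟩
  have hl : ∀ v, ((e₁.trans (Equiv.sumCongr e₂ e₃)) v).isLeft ↔ v = c := by
    intro v
    by_cases hv : v = c
    · simp [e₁, hv]
    · simp [e₁, hv]
  have hr : ∀ v, ((e₁.trans (Equiv.sumCongr e₂ e₃)) v).isRight ↔ v ≠ c := by
    intro v
    by_cases hv : v = c
    · simp [e₁, hv]
    · simp [e₁, hv]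
  simp only [completeBipartiteGraph_adj, hl, hr]
  constructor
  · rintro (⟨rfl, h⟩ | ⟨h, rfl⟩)
    exacts [(hadj b h).symm, hadj a h]
  · intro h
    by_cases ha : a = c
    · exact Or.inl ⟨ha, fun hb => h.ne (ha.trans hb.symm)⟩
    · by_cases hb : b = c
      · exact Or.inr ⟨ha, hb⟩
      · exact absurd (vertexDegree_le_one_iff.1 (hc a ha) b c h (hadj a ha)) hb

theorem Connected.nonempty_iso_pathGraph_two [Finite V] [Nontrivial V] {G : SimpleGraph V}
    (hG : G.Connected) (hc : ∀ w, G.vertexDegree w ≤ 1) :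
    Nonempty (G ≃g pathGraph 2) := by
  classical
  obtain ⟨a, b, hab⟩ := exists_pair_ne V
  have hadj := fun (v w : V) (h : v ≠ w) =>
    hG.adj_of_forall_vertexDegree_le_one (c := w) (fun w _ => hc w) h
  have hall : ∀ v, v ≠ a → v = b := fun v hv =>
    vertexDegree_le_one_iff.1 (hc a) v b (hadj v a hv).symm (hadj a b hab)
  have hcard : Nat.card V = 2 := by
    rw [Nat.card_eq_two_iff]
    refine ⟨a, b, hab, Set.eq_univ_of_forall fun v => ?_⟩
    by_cases hv : v = a
    · exact Or.inl hv
    · exact Or.inr (hall v hv)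
  have e : V ≃ Fin 2 := Finite.equivFinOfCardEq hcard
  refine ⟨⟨e, fun {v w} => ?_⟩⟩
  have h1 : (pathGraph 2).Adj (e v) (e w) ↔ e v ≠ e w := by
    rw [pathGraph_adj, ne_eq, Fin.ext_iff]
    omega
  rw [h1, e.injective.ne_iff]
  exact ⟨hadj v w, fun h => h.ne⟩

/-- Without trimmable edges, having at most one vertex of degree three or more means being `P₂` or a
star with at least three leaves. -/
theorem Connected.exists_vertexDegree_le_two_iff [Finite V] [Nontrivial V] {G : SimpleGraph V}
    (hG : G.Connected) (htrim : ∀ x y, ¬ G.IsTrimmableEdge x y) :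
    (∃ c, ∀ w ≠ c, G.vertexDegree w ≤ 2) ↔ Nonempty (G ≃g pathGraph 2) ∨
      ∃ n : ℕ, 4 ≤ n ∧ Nonempty (G ≃g completeBipartiteGraph (Fin 1) (Fin (n - 1))) := by
  constructor
  · rintro ⟨c, hc⟩
    by_cases hc2 : G.vertexDegree c ≤ 2
    · left
      refine hG.nonempty_iso_pathGraph_two fun w => ?_
      have hall : ∀ w, G.vertexDegree w ≤ 2 := fun w => by
        by_cases hw : w = c
        · exact hw ▸ hc2
        · exact hc w hw
      by_contra! hw
      obtain ⟨z, hz⟩ := hG.preconnected.exists_adj_of_nontrivial w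
      exact htrim w z ⟨hz, Or.inl ⟨le_antisymm (hall w) hw, hall z⟩⟩
    · right
      have hleaf : ∀ w ≠ c, G.vertexDegree w ≤ 1 := by
        intro w hw
        by_contra! h2
        have h2' : G.vertexDegree w = 2 := le_antisymm (hc w hw) h2
        obtain ⟨a, b, hab, hset⟩ := Set.ncard_eq_two.1 h2'
        have ha : G.Adj w a := by
          change a ∈ G.neighborSet w
          simp [hset]
        have hb : G.Adj w b := by
          change b ∈ G.neighborSet w
          simp [hset]
        by_cases hac : a = c
        · exact htrim w b ⟨hb, Or.inl ⟨h2', hc b fun h => hab (hac.trans h.symm)⟩⟩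
        · exact htrim w a ⟨ha, Or.inl ⟨h2', hc a hac⟩⟩
      refine ⟨Nat.card V, ?_, hG.nonempty_iso_completeBipartiteGraph hleaf⟩
      have h1 : G.neighborSet c ⊆ {c}ᶜ := fun w hw => (G.ne_of_adj hw).symm
      have h2 := Set.ncard_le_ncard h1 (Set.toFinite _)
      have h3 := Set.ncard_add_ncard_compl {c}
      rw [Set.ncard_singleton] at h3
      unfold vertexDegree at hc2
      omega
  · rintro (⟨⟨e⟩⟩ | ⟨n, -, ⟨e⟩⟩)
    · refine ⟨e.symm 0, fun w _ => ?_⟩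
      rw [← e.vertexDegree_eq w]
      exact vertexDegree_le_two_of_forall (a := 0) (b := 1) fun x _ => by omega
    · refine ⟨e.symm (Sum.inl 0), fun w hw => ?_⟩
      rw [← e.vertexDegree_eq w]
      refine vertexDegree_le_two_of_forall (a := Sum.inl 0) (b := Sum.inl 0) fun x hx => ?_
      have hw' : e w ≠ Sum.inl 0 := fun h => hw (by rw [← h, e.symm_apply_apply])
      rcases hew : e w with i | i
      · exact absurd (hew.trans (by rw [Subsingleton.elim i 0])) hw'
      · rcases x with j | j
        · rw [Subsingleton.elim j 0]
          exact Or.inl rfl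
        · simp [hew] at hx

/-- A trimmed tree is `P₂` or a star with at least three leaves exactly when the tree has at most
one vertex of degree three or more. -/
theorem IsTrimOf.exists_vertexDegree_le_two_iff {W : Type w} {H : SimpleGraph W}
    {G : SimpleGraph V} (h : H.IsTrimOf G) (hfin : Finite V) (hnt : Nontrivial V) (hG : G.IsTree) :
    (∃ c, ∀ w ≠ c, G.vertexDegree w ≤ 2) ↔ Nonempty (H ≃g pathGraph 2) ∨
      ∃ n : ℕ, 4 ≤ n ∧ Nonempty (H ≃g completeBipartiteGraph (Fin 1) (Fin (n - 1))) := by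
  induction h with
  | done G htrim e =>
    rw [hG.connected.exists_vertexDegree_le_two_iff htrim]
    refine or_congr ⟨fun ⟨f⟩ => ⟨e.symm.trans f⟩, fun ⟨f⟩ => ⟨e.trans f⟩⟩
      (exists_congr fun n => and_congr_right fun _ =>
        ⟨fun ⟨f⟩ => ⟨e.symm.trans f⟩, fun ⟨f⟩ => ⟨e.trans f⟩⟩)
  | @contract V G x y hxy _ ih =>
    rw [← hG.exists_vertexDegree_le_two_contractEdge_iff hxy]
    refine ih inferInstance ?_ (hG.contractEdge hxy.1)
    -- One end of `xy` has degree two, so there is a third vertex.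
    have : ∃ z, z ≠ x ∧ z ≠ y := by
      by_contra! hall
      have h1 : G.vertexDegree x ≤ 1 := vertexDegree_le_one_iff.2 fun a b ha hb => by
        rw [hall a (G.ne_of_adj ha).symm, hall b (G.ne_of_adj hb).symm]
      have h2 : G.vertexDegree y ≤ 1 := vertexDegree_le_one_iff.2 fun a b ha hb => by
        by_contra hab
        by_cases hax : a = x
        · exact (G.ne_of_adj hb).symm (hall b fun h => hab (hax.trans h.symm))
        · exact (G.ne_of_adj ha).symm (hall a hax)
      rcases hxy.2 with h | h <;> omega
    obtain ⟨z, hzx, hzy⟩ := this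
    exact ⟨⟨⟨x, hxy.1.ne⟩, ⟨z, hzy⟩, fun h => hzx (congrArg Subtype.val h).symm⟩⟩

/-- Trimming terminates, since every contraction removes a vertex. -/
theorem exists_isTrimOf [Finite V] (G : SimpleGraph V) :
    ∃ (n : ℕ) (H : SimpleGraph (Fin n)), H.IsTrimOf G := by
  induction hn : Nat.card V generalizing V with
  | zero =>
    have : IsEmpty V := Finite.card_eq_zero_iff.1 hn
    have := Fintype.ofFinite V
    exact ⟨_, _, .done G (fun x => isEmptyElim x) (G.overFinIso rfl)⟩
  | succ n ih =>
    by_cases h : ∃ x y, G.IsTrimmableEdge x y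
    · obtain ⟨x, y, hxy⟩ := h
      obtain ⟨m, H, hH⟩ := ih (G.contractEdge x y) (by
        have := card_contractEdge (V := V) (y := y)
        omega)
      exact ⟨m, H, .contract G x y hxy hH⟩
    · push Not at h
      have := Fintype.ofFinite V
      exact ⟨_, _, .done G h (G.overFinIso rfl)⟩

/-! ### Trees realizing all pairs of values -/

/-- The graph given by a parent function `q` that decreases a rank `t` off the root `r` is a
tree. -/
theorem isTree_fromRel_of_lt [Finite V] (r : V) (q : V → V) (t : V → ℕ)
    (h : ∀ v ≠ r, t (q v) < t v) : (fromRel fun v w => v ≠ r ∧ w = q v).IsTree := by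
  set G := fromRel fun v w => v ≠ r ∧ w = q v
  have hreach : ∀ k v, t v = k → G.Reachable v r := by
    intro k
    induction k using Nat.strong_induction_on with
    | _ k ih =>
      intro v hv
      by_cases hvr : v = r
      · exact hvr ▸ Reachable.refl _
      · have hlt := h v hvr
        have hadj : G.Adj v (q v) :=
          (fromRel_adj _ _ _).2 ⟨fun heq => by rw [← heq] at hlt; omega, Or.inl ⟨hvr, rfl⟩⟩
        exact hadj.reachable.trans (ih _ (hv ▸ hlt) _ rfl)
  have : Nonempty V := ⟨r⟩
  have hconn : G.Connected :=
    ⟨fun a b => (hreach _ a rfl).trans (hreach _ b rfl).symm⟩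
  refine isTree_iff_connected_and_card.2
    ⟨hconn, le_antisymm ?_ hconn.card_vert_le_card_edgeSet_add_one⟩
  have h1 : G.edgeSet ⊆ (fun v => s(v, q v)) '' {r}ᶜ := by
    intro e he
    induction e with | h a b =>
    have hab : G.Adj a b := he
    obtain ⟨-, ⟨hr, rfl⟩ | ⟨hr, rfl⟩⟩ := (fromRel_adj _ _ _).1 hab
    exacts [⟨a, hr, rfl⟩, ⟨b, hr, Sym2.eq_swap⟩]
  have h2 := (Set.ncard_le_ncard h1 (Set.toFinite _)).trans (Set.ncard_image_le (Set.toFinite _))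
  have h3 := Set.ncard_add_ncard_compl {r}
  rw [Set.ncard_singleton] at h3
  have h4 : Nat.card G.edgeSet = G.edgeSet.ncard := rfl
  omega

/-- If every edge of `G` meets `A`, then a spanning linear forest has at most two edges for each
vertex of `A`. -/
theorem card_le_pathCoverNumber_add_two_mul [Finite V] {G : SimpleGraph V}
    {A : Set V} (hA : ∀ a b, G.Adj a b → a ∈ A ∨ b ∈ A) :
    Nat.card V ≤ G.pathCoverNumber + 2 * A.ncard := by
  classical
  have := Fintype.ofFinite V
  obtain ⟨C, hC, hcard⟩ := exists_isMinimumPathCover G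
  have h1 := hC.ncard_edgeSet_add_card
  have h2 : (coverGraph C).edgeSet.toFinset ⊆ A.toFinset.biUnion fun a =>
      ((coverGraph C).neighborSet a).toFinset.image fun w => s(a, w) := by
    intro e he
    induction e with | h a b =>
    have hab : (coverGraph C).Adj a b := by simpa using he
    rcases hA a b (coverGraph_le C hab) with h | h
    · exact Finset.mem_biUnion.2 ⟨a, Set.mem_toFinset.2 h,
        Finset.mem_image.2 ⟨b, Set.mem_toFinset.2 hab, rfl⟩⟩
    · exact Finset.mem_biUnion.2 ⟨b, Set.mem_toFinset.2 h,
        Finset.mem_image.2 ⟨a, Set.mem_toFinset.2 hab.symm, Sym2.eq_swap⟩⟩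
  have h3 := (Finset.card_le_card h2).trans (Finset.card_biUnion_le_card_mul _ _ 2 fun a _ => by
    refine Finset.card_image_le.trans ?_
    rw [← Set.ncard_eq_toFinset_card']
    exact hC.vertexDegree_le_two a)
  rw [← Set.ncard_eq_toFinset_card', ← Set.ncard_eq_toFinset_card'] at h3
  omega

section caterpillar

variable {j m : ℕ}

/-- The parent function of the caterpillar on `{0, …, j + m - 1}` with spine `0, …, j - 1`: the
parent of a spine vertex `i` is `i - 1`, and the vertices `j + k` with `k < m` are leaves, two at
each spine vertex except that the last spine vertex receives all remaining leaves. -/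
def caterpillarParent (hj : 0 < j) (v : Fin (j + m)) : Fin (j + m) :=
  ⟨if (v : ℕ) < j then v - 1 else min ((v - j) / 2) (j - 1), by split_ifs <;> omega⟩

/-- The caterpillar with spine of length `j` and `m` leaves, see `caterpillarParent`. -/
def caterpillar (m : ℕ) (hj : 0 < j) : SimpleGraph (Fin (j + m)) :=
  fromRel fun v w => v ≠ ⟨0, by omega⟩ ∧ w = caterpillarParent hj v

theorem caterpillarParent_val_of_lt (hj : 0 < j) {v : Fin (j + m)} (hv : (v : ℕ) < j) :
    (caterpillarParent hj v : ℕ) = v - 1 := if_pos hv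

theorem caterpillarParent_val_of_le (hj : 0 < j) {v : Fin (j + m)} (hv : j ≤ (v : ℕ)) :
    (caterpillarParent hj v : ℕ) = min ((v - j) / 2) (j - 1) := if_neg (not_lt.2 hv)

theorem caterpillarParent_lt (hj : 0 < j) (v : Fin (j + m)) :
    (caterpillarParent hj v : ℕ) < j := by
  by_cases hv : (v : ℕ) < j
  · rw [caterpillarParent_val_of_lt hj hv]
    omega
  · rw [caterpillarParent_val_of_le hj (not_lt.1 hv)]
    omega

theorem caterpillar_isTree (hj : 0 < j) : (caterpillar m hj).IsTree := by
  refine isTree_fromRel_of_lt _ _ Fin.val fun v hv => ?_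
  have hv0 : (v : ℕ) ≠ 0 := fun h => hv (Fin.ext h)
  by_cases hvj : (v : ℕ) < j
  · rw [caterpillarParent_val_of_lt hj hvj]
    omega
  · exact (caterpillarParent_lt hj v).trans_le (not_lt.1 hvj)

theorem caterpillar_adj_parent (hj : 0 < j) {v : Fin (j + m)} (hv : j ≤ (v : ℕ)) :
    (caterpillar m hj).Adj v (caterpillarParent hj v) := by
  have hlt := caterpillarParent_lt hj v
  refine (fromRel_adj _ _ _).2 ⟨fun h => ?_, Or.inl ⟨fun h => ?_, rfl⟩⟩
  · rw [← h] at hlt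
    omega
  · rw [h] at hv
    simp only at hv
    omega

theorem eq_caterpillarParent_of_adj (hj : 0 < j) {v w : Fin (j + m)} (hv : j ≤ (v : ℕ))
    (h : (caterpillar m hj).Adj v w) : w = caterpillarParent hj v := by
  obtain ⟨-, ⟨-, h⟩ | ⟨-, h⟩⟩ := (fromRel_adj _ _ _).1 h
  · exact h
  · have := caterpillarParent_lt hj w
    rw [← h] at this
    omega

theorem caterpillar_isLeafVertex (hj : 0 < j) {v : Fin (j + m)} (hv : j ≤ (v : ℕ)) :
    (caterpillar m hj).IsLeafVertex v := by
  refine le_antisymm ?_ (vertexDegree_pos_iff.2 ⟨_, caterpillar_adj_parent hj hv⟩)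
  rw [vertexDegree_le_one_iff]
  intro a b ha hb
  rw [eq_caterpillarParent_of_adj hj hv ha, eq_caterpillarParent_of_adj hj hv hb]

theorem ncard_spine : {v : Fin (j + m) | (v : ℕ) < j}.ncard = j := by
  have h : {v : Fin (j + m) | (v : ℕ) < j} = Set.range (Fin.castAdd m) := by
    ext v
    exact ⟨fun hv => ⟨⟨v, hv⟩, rfl⟩, by rintro ⟨i, rfl⟩; exact i.2⟩
  rw [h, ← Set.image_univ, Set.ncard_image_of_injective _ (Fin.castAdd_injective _ _),
    Set.ncard_univ, Nat.card_fin]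

theorem ncard_compl_spine : {v : Fin (j + m) | j ≤ (v : ℕ)}.ncard = m := by
  have h := Set.ncard_add_ncard_compl {v : Fin (j + m) | (v : ℕ) < j}
  have h2 : {v : Fin (j + m) | (v : ℕ) < j}ᶜ = {v : Fin (j + m) | j ≤ (v : ℕ)} := by
    ext v
    simp
  rw [h2, ncard_spine, Nat.card_fin] at h
  omega

/-- The first leaf at the spine vertex `i`. -/
def firstLeaf (hm : 2 * j ≤ m) (i : Fin j) : Fin (j + m) := ⟨j + 2 * i, by omega⟩

/-- The second leaf at the spine vertex `i`. -/
def secondLeaf (hm : 2 * j ≤ m) (i : Fin j) : Fin (j + m) := ⟨j + 2 * i + 1, by omega⟩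

theorem caterpillarParent_firstLeaf (hj : 0 < j) (hm : 2 * j ≤ m) (i : Fin j) :
    (caterpillarParent hj (firstLeaf hm i) : ℕ) = i := by
  rw [caterpillarParent_val_of_le hj (by simp [firstLeaf])]
  simp only [firstLeaf]
  omega

theorem caterpillarParent_secondLeaf (hj : 0 < j) (hm : 2 * j ≤ m) (i : Fin j) :
    (caterpillarParent hj (secondLeaf hm i) : ℕ) = i := by
  rw [caterpillarParent_val_of_le hj (by simp only [secondLeaf]; omega)]
  simp only [secondLeaf]
  omega

theorem ncard_range_firstLeaf (hm : 2 * j ≤ m) : (Set.range (firstLeaf hm)).ncard = j := by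
  rw [← Set.image_univ, Set.ncard_image_of_injective, Set.ncard_univ, Nat.card_fin]
  intro a b h
  simp only [firstLeaf, Fin.mk.injEq] at h
  exact Fin.ext (by omega)

/-- All vertices except one leaf at each spine vertex form a total forcing set. -/
theorem caterpillar_isTotalForcingSet (hj : 0 < j) (hm : 2 * j ≤ m) :
    (caterpillar m hj).IsTotalForcingSet (Set.range (firstLeaf hm))ᶜ := by
  have hspine : ∀ v : Fin (j + m), (v : ℕ) < j → v ∈ (Set.range (firstLeaf hm))ᶜ := by
    rintro v hv ⟨i, rfl⟩
    simp only [firstLeaf] at hv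
    omega
  have hpar : ∀ v : Fin (j + m), caterpillarParent hj v ∈ (Set.range (firstLeaf hm))ᶜ :=
    fun v => hspine _ (caterpillarParent_lt hj v)
  have hfirst : ∀ i, j ≤ (firstLeaf hm i : ℕ) := fun i => by simp [firstLeaf]
  constructor
  · refine (caterpillar_isTree hj).isAcyclic.isForcingSet le_rfl (fun v => ?_) ?_ ?_
    · exact ⟨_, hpar v, (caterpillar_isTree hj).connected.preconnected _ _⟩
    · intro s _ a b ha hb haS hbS
      obtain ⟨i, rfl⟩ := not_not.1 haS
      obtain ⟨k, rfl⟩ := not_not.1 hbS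
      have h1 := eq_caterpillarParent_of_adj hj (hfirst i) ha.symm
      have h2 := eq_caterpillarParent_of_adj hj (hfirst k) hb.symm
      have h3 := caterpillarParent_firstLeaf hj hm i
      have h4 := caterpillarParent_firstLeaf hj hm k
      rw [← h1] at h3
      rw [← h2] at h4
      rw [Fin.ext (h3.symm.trans h4)]
    · intro v hv
      obtain ⟨i, rfl⟩ := not_not.1 hv
      exact (le_of_eq (caterpillar_isLeafVertex hj (hfirst i))).trans one_le_two
  · intro v hv
    by_cases hvj : (v : ℕ) < j
    · refine ⟨secondLeaf hm ⟨v, hvj⟩, ?_, ?_⟩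
      · rintro ⟨i, hi⟩
        simp only [firstLeaf, secondLeaf, Fin.mk.injEq] at hi
        omega
      · have h := caterpillar_adj_parent hj (v := secondLeaf hm ⟨v, hvj⟩)
          (by simp only [secondLeaf]; omega)
        have h2 : caterpillarParent hj (secondLeaf hm ⟨v, hvj⟩) = v :=
          Fin.ext (caterpillarParent_secondLeaf hj hm ⟨v, hvj⟩)
        rw [h2] at h
        exact h.symm
    · exact ⟨_, hpar v, caterpillar_adj_parent hj (not_lt.1 hvj)⟩

theorem caterpillar_totalForcingNumber (hj : 0 < j) (hm : 2 * j ≤ m) :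
    (caterpillar m hj).totalForcingNumber = m := by
  have : Nontrivial (Fin (j + m)) := Fin.nontrivial_iff_two_le.2 (by omega)
  refine le_antisymm ?_ ?_
  · refine (totalForcingNumber_le (Set.toFinite _) (caterpillar_isTotalForcingSet hj hm)).trans ?_
    have h := Set.ncard_add_ncard_compl (Set.range (firstLeaf hm))
    rw [ncard_range_firstLeaf, Nat.card_fin] at h
    omega
  · refine le_trans ?_ (caterpillar_isTree hj).ncard_isLeafVertex_le_totalForcingNumber
    refine le_trans (le_of_eq (ncard_compl_spine (j := j) (m := m)).symm) ?_
    exact Set.ncard_le_ncard (fun v hv => caterpillar_isLeafVertex hj hv) (Set.toFinite _)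

/-- The forcing chains of the total forcing set above, joined by an edge at each spine vertex, give
a path cover with `m - j` paths; there is no smaller one since the spine meets every edge. -/
theorem caterpillar_pathCoverNumber (hj : 0 < j) (hm : 2 * j ≤ m) :
    (caterpillar m hj).pathCoverNumber + j = m := by
  have htree := caterpillar_isTree (m := m) hj
  refine le_antisymm ?_ ?_
  · have hS := caterpillar_isTotalForcingSet hj hm
    obtain ⟨t, p, hp⟩ := hS.1.exists_isChronology
    let f : Fin j → Sym2 (Fin (j + m)) := fun i =>
      s(secondLeaf hm i, caterpillarParent hj (secondLeaf hm i))
    have hleaf : ∀ i, j ≤ (secondLeaf hm i : ℕ) := fun i => by simp only [secondLeaf]; omega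
    have hadj : ∀ a b, (fromEdgeSet (Set.range f)).Adj a b → ∃ i,
        (a = secondLeaf hm i ∧ (b : ℕ) = i) ∨ (b = secondLeaf hm i ∧ (a : ℕ) = i) := by
      intro a b hab
      obtain ⟨⟨i, hi⟩, -⟩ := (fromEdgeSet_adj _).1 hab
      refine ⟨i, ?_⟩
      rcases Sym2.eq_iff.1 hi with ⟨rfl, rfl⟩ | ⟨rfl, rfl⟩
      · exact Or.inl ⟨rfl, caterpillarParent_secondLeaf hj hm i⟩
      · exact Or.inr ⟨rfl, caterpillarParent_secondLeaf hj hm i⟩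
    have h := hp.pathCoverNumber_add_ncard_edgeSet_le htree.isAcyclic
      (K := fromEdgeSet (Set.range f)) ?_ ?_ ?_
    · have hE : Set.range f ⊆ (fromEdgeSet (Set.range f)).edgeSet := by
        rintro _ ⟨i, rfl⟩
        exact (fromEdgeSet_adj _).2 ⟨⟨i, rfl⟩, (caterpillar_adj_parent hj (hleaf i)).ne⟩
      have hcard : (Set.range f).ncard = j := by
        rw [← Set.image_univ, Set.ncard_image_of_injective, Set.ncard_univ, Nat.card_fin]
        intro a b hab
        have ha := caterpillarParent_secondLeaf hj hm a
        have hb := caterpillarParent_secondLeaf hj hm b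
        rcases Sym2.eq_iff.1 hab with ⟨-, h2⟩ | ⟨h1, -⟩
        · rw [h2] at ha
          exact Fin.ext (ha.symm.trans hb)
        · have h3 := caterpillarParent_lt hj (secondLeaf hm b)
          rw [← h1] at h3
          exact absurd h3 (not_lt.2 (hleaf a))
      have h1 := Set.ncard_le_ncard hE (Set.toFinite _)
      have h2 := Set.ncard_add_ncard_compl (Set.range (firstLeaf hm))
      rw [ncard_range_firstLeaf, Nat.card_fin] at h2
      omega
    · intro a b hab
      obtain ⟨⟨i, hi⟩, -⟩ := (fromEdgeSet_adj _).1 hab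
      rw [← mem_edgeSet, ← hi]
      exact caterpillar_adj_parent hj (hleaf i)
    · rintro a b hab ⟨k, rfl⟩
      obtain ⟨i, ⟨h, -⟩ | ⟨-, h⟩⟩ := hadj _ _ hab
      · simp only [firstLeaf, secondLeaf, Fin.mk.injEq] at h
        omega
      · simp only [firstLeaf] at h
        omega
    · intro a b c hab hac
      obtain ⟨i, hi⟩ := hadj _ _ hab
      obtain ⟨k, hk⟩ := hadj _ _ hac
      simp only [secondLeaf, Fin.ext_iff] at hi hk ⊢
      omega
  · have h := card_le_pathCoverNumber_add_two_mul (G := caterpillar m hj)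
      (A := {v | (v : ℕ) < j}) (by
        intro a b hab
        by_cases ha : (a : ℕ) < j
        · exact Or.inl ha
        · right
          rw [eq_caterpillarParent_of_adj hj (not_lt.1 ha) hab]
          exact caterpillarParent_lt hj a)
    rw [ncard_spine, Nat.card_fin] at h
    omega

end caterpillar

end SimpleGraph

theorem theorem1 :
    (∀ (V : Type*) [Finite V] [Nontrivial V] (T : SimpleGraph V), T.IsTree →
      T.pathCoverNumber + 1 ≤ T.totalForcingNumber ∧
      T.totalForcingNumber ≤ 2 * T.pathCoverNumber ∧
      (∃ (n : ℕ) (T' : SimpleGraph (Fin n)), T'.IsTrimOf T) ∧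
      (∀ (W : Type*) (T' : SimpleGraph W), T'.IsTrimOf T →
        (T.totalForcingNumber = T.pathCoverNumber + 1 ↔
          Nonempty (T' ≃g SimpleGraph.pathGraph 2) ∨
          ∃ n : ℕ, 4 ≤ n ∧
            Nonempty (T' ≃g completeBipartiteGraph (Fin 1) (Fin (n - 1))))) ∧
      (T.totalForcingNumber = 2 * T.pathCoverNumber ↔
        ∃ C : Finset T.Subgraph, T.IsMinimumPathCover C ∧
          (∀ D : Finset T.Subgraph, T.IsMinimumPathCover D → D = C) ∧
          ∀ P ∈ C, ∃ u v : V, u ≠ v ∧ T.IsLeafVertex u ∧ T.IsLeafVertex v ∧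
            T.IsPathBetween P u v)) ∧
    (∀ l m : ℕ, l + 1 ≤ m → m ≤ 2 * l →
      ∃ (n : ℕ) (T : SimpleGraph (Fin n)), 2 ≤ n ∧ T.IsTree ∧
        T.pathCoverNumber = l ∧ T.totalForcingNumber = m) := by
  refine ⟨fun V _ _ T hT => ⟨hT.pathCoverNumber_lt_totalForcingNumber,
    hT.totalForcingNumber_le_two_mul, T.exists_isTrimOf, fun W T' h => ?_,
    hT.totalForcingNumber_eq_two_mul_iff⟩, fun l m h1 h2 => ?_⟩
  · rw [hT.totalForcingNumber_eq_pathCoverNumber_add_one_iff]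
    exact h.exists_vertexDegree_le_two_iff inferInstance inferInstance hT
  · -- A caterpillar with `m` leaves and `m - l` spine vertices.
    have hj : 0 < m - l := by omega
    have h := SimpleGraph.caterpillar_pathCoverNumber (m := m) hj (by omega)
    exact ⟨_, _, by omega, SimpleGraph.caterpillar_isTree hj, by omega,
      SimpleGraph.caterpillar_totalForcingNumber hj (by omega)⟩
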